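/- Work over the field $\mathbb{Q}(q)$ of rational functions in an indeterminate $q$. **Rooted trees.** Let $\mathsf{PL}=\bigoplus_{n\ge 1}\mathsf{PL}_n$ be the free (right) pre-Lie algebra on one generator, realized on the vector space with basis the rooted trees, $\mathsf{PL}_n$ being spanned by the trees with $n$ vertices; the product $T\curvearrowleft T'$ is the sum of all trees obtained by adding an edge from the root of $T'$ to a vertex of $T$, and the generator is the one-vertex tree $\bullet$. Let $\widehat{\mathsf{PL}}=\prod_{n\ge1}\mathsf{PL}_n$. For $A,x\in\widehat{\mathsf{PL}}$ and a power series $f(z)=\sum_k f_kz^k$ put $x\curvearrowleft f(A)=\sum_k f_k\,((x\curvearrowleft A)\curvearrowleft\cdots)\curvearrowleft A$ ($k$ factors $A$ in the $k$-th term). Let $\Omega$ be the unique element of $\widehat{\mathsf{PL}}$ with $$\bullet\curvearrowleft\Big(\frac{\Omega}{\exp(\Omega)-1}\Big)=\Omega ,$$ and, writing $A[q]=\sum_n q^nA_n$ for $A=\sum_n A_n$, let $\Omega_q=\sum_{n\ge1}\Omega_{q,n}$ be the unique element of $\widehat{\mathsf{PL}}$ with $$\Omega_q[q]\curvearrowleft(\exp(\Omega)-1)+\Omega_q[q]-\Omega_q=\bullet\curvearrowleft\Omega_q+(q-1)\,\bullet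 .$$ The suspension of $A=\sum_n A_n$ is $\sum_{n\ge1}(-1)^{n-1}A_n$. **Planar binary trees.** Let $\operatorname{Dend}$ be the free dendriform algebra on one generator $Y$, realized on the vector space with basis the planar binary trees with at least one inner vertex, with $(l\vee r)\prec s=l\vee(r*s)$, $s\succ(l\vee r)=(s*l)\vee r$ and $x*y=x\succ y+x\prec y$; adjoin a unit $1$ for $*$. Let $L_0=1$, $L_1=Y$, $L_{n+1}=L_n\succ Y$ be the left combs. Let $\phi:\mathsf{PL}\to\operatorname{Dend}$ be the unique linear map with $\phi(\bullet)=Y$ and $\phi(x\curvearrowleft y)=\phi(y)\succ\phi(x)-\phi(x)\prec\phi(y)$, extended degree by degree to the completions. **Noncommutative symmetric functions.** Let $\mathbf{Sym}$ be the free unital associative algebra on $S_1,S_2,\dots$, with $S_0=1$; let $\Psi_n$ ($n\ge1$) be determined by $nS_n=\sum_{i=0}^{n-1}S_i\Psi_{n-i}$. Let $S_n(\frac{A}{1-q})$ be determined by $S_0(\frac{A}{1-q})=1$ and $S_n(\frac{A}{1-q})=\sum_{i+j=n}q^iS_i(\frac{A}{1-q})S_j$, that is, their generating series is the infinite product $\cdots\sigma(q^2t)\sigma(qt)\sigma(t)$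 with $\sigma(t)=\sum_nS_nt^n$, and let $\Psi_n(\frac{A}{1-q})$ be the image of $\Psi_n$ under the algebra endomorphism $S_n\mapsto S_n(\frac{A}{1-q})$. Let $\theta$ be the morphism of unital algebras from $\mathbf{Sym}$ to $\operatorname{Dend}$ (with unit) such that $\theta(S_n)=L_n$ for all $n$. **Proposition.** The image under $\theta$ of $(1-q)\sum_{n\ge1}\Psi_n(\frac{A}{1-q})$ is the image under $\phi$ of the suspension of $\Omega_q$; that is, for all $n\ge1$, $$\theta\Big((1-q)\,\Psi_n\big(\tfrac{A}{1-q}\big)\Big)=(-1)^{n-1}\,\phi(\Omega_{q,n}).$$ -/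

import Mathlib

namespace QOmega

/-! ### Rooted trees -/

/-- Planar (ordered) rooted trees: `vertex` is the one-vertex tree, and `attach a b` is `a` with
one more (last) subtree `b` on its root, i.e. with a new edge from the root of `b` to the root of
`a`. -/
inductive PlanarTree : Type
  | vertex : PlanarTree
  | attach (a b : PlanarTree) : PlanarTree

namespace PlanarTree

/-- Exchange of two neighbouring subtrees of one vertex. -/
inductive Swap : PlanarTree → PlanarTree → Prop
  | swap (a b c : PlanarTree) : Swap ((a.attach b).attach c) ((a.attach c).attach b)
  | left {a a' : PlanarTree} (b : PlanarTree) : Swap a a' → Swap (a.attach b) (a'.attach b)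
  | right (a : PlanarTree) {b b' : PlanarTree} : Swap b b' → Swap (a.attach b) (a.attach b')

/-- The number of vertices. -/
def order : PlanarTree → ℕ
  | vertex => 1
  | attach a b => a.order + b.order

/-- The number of edges at the root. -/
def rootDegree : PlanarTree → ℕ
  | vertex => 0
  | attach a _ => a.rootDegree + 1

end PlanarTree

/-- (Unlabelled, non-planar) rooted trees: planar rooted trees up to reordering the subtrees
of the vertices. -/
def RTree : Type := Quot PlanarTree.Swap

namespace RTree

/-- The rooted tree underlying a planar rooted tree. -/
def mk (a : PlanarTree) : RTree := Quot.mk _ a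

theorem mk_eq {a b : PlanarTree} (h : a.Swap b) : mk a = mk b := Quot.sound h

/-- The tree with one vertex. -/
def vertex : RTree := mk .vertex

/-- Add an edge from the root of the second tree to the root of the first one. -/
def attach : RTree → RTree → RTree :=
  Quot.map₂ PlanarTree.attach (fun a _ _ h => .right a h) (fun _ _ b h => .left b h)

theorem attach_swap (a b c : RTree) : (a.attach b).attach c = (a.attach c).attach b := by
  induction a using Quot.ind
  induction b using Quot.ind
  induction c using Quot.ind
  exact Quot.sound (.swap _ _ _)

theorem ind {P : RTree → Prop} (h0 : P vertex)
    (h1 : ∀ a b, P a → P b → P (attach a b)) (T : RTree) : P T := by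
  induction T using Quot.ind with
  | mk a =>
    induction a with
    | vertex => exact h0
    | attach a b iha ihb => exact h1 _ _ iha ihb

/-- The number of vertices. -/
def order : RTree → ℕ :=
  Quot.lift PlanarTree.order (by
    intro a b h
    induction h with
    | swap a b c => simp only [PlanarTree.order]; omega
    | left b _ ih => simp only [PlanarTree.order, ih]
    | right a _ ih => simp only [PlanarTree.order, ih])

theorem order_vertex : vertex.order = 1 := rfl

theorem order_attach (a b : RTree) : (attach a b).order = a.order + b.order := by
  induction a using Quot.ind
  induction b using Quot.ind
  rfl

theorem order_pos (a : RTree) : 0 < a.order := by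
  induction a using ind with
  | h0 => simp [order_vertex]
  | h1 a b ha hb => rw [order_attach]; omega

/-- The number of edges at the root. -/
def rootDegree : RTree → ℕ :=
  Quot.lift PlanarTree.rootDegree (by
    intro a b h
    induction h with
    | swap a b c => simp only [PlanarTree.rootDegree]
    | left b _ ih => simp only [PlanarTree.rootDegree, ih]
    | right a _ ih => simp only [PlanarTree.rootDegree])

theorem rootDegree_attach (a b : RTree) : (attach a b).rootDegree = a.rootDegree + 1 := by
  induction a using Quot.ind
  induction b using Quot.ind
  rfl

end RTree

/-- Auxiliary form of `RTree.graft`. A vertex of `attach a b` is a vertex of `a` or a vertex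
of `b`. -/
def PlanarTree.graft : PlanarTree → RTree → Multiset RTree
  | .vertex, t => {RTree.vertex.attach t}
  | .attach a b, t =>
      (a.graft t).map (fun x => x.attach (RTree.mk b)) +
      (b.graft t).map (fun x => (RTree.mk a).attach x)

namespace RTree

/-- The multiset of all trees obtained from the disjoint union of `T` and `T'` by adding an edge
from the root of `T'` to one of the vertices of `T`. -/
def graft (T T' : RTree) : Multiset RTree :=
  Quot.lift (fun a => PlanarTree.graft a T') (by
    intro a b h
    induction h with
    | swap a b c =>
      have e (x y : PlanarTree) : mk (x.attach y) = (mk x).attach (mk y) := rfl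
      simp only [PlanarTree.graft, Multiset.map_add, Multiset.map_map, Function.comp_def, e]
      rw [add_assoc, add_assoc]
      congr 1
      · simp only [attach_swap _ (mk b) (mk c)]
      · rw [add_comm]
        simp only [attach_swap (mk a) _ (mk c), attach_swap (mk a) _ (mk b)]
    | left b h ih => simp only [PlanarTree.graft, ih, mk_eq h]
    | right a h ih => simp only [PlanarTree.graft, ih, mk_eq h]) T

theorem graft_vertex (t : RTree) : graft vertex t = {vertex.attach t} := rfl

theorem graft_attach (a b t : RTree) : graft (attach a b) t =
    (graft a t).map (fun x => x.attach b) + (graft b t).map (fun x => a.attach x) := by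
  induction a using Quot.ind
  induction b using Quot.ind
  rfl

theorem order_graft (a b : RTree) : ∀ x ∈ graft a b, x.order = a.order + b.order := by
  induction a using ind with
  | h0 => simp [graft_vertex, order_attach]
  | h1 a c iha ihc =>
    intro x hx
    rw [graft_attach, Multiset.mem_add, Multiset.mem_map, Multiset.mem_map] at hx
    rcases hx with ⟨y, hy, rfl⟩ | ⟨y, hy, rfl⟩
    · have := iha y hy
      simp only [order_attach]; omega
    · have := ihc y hy
      simp only [order_attach]; omega

theorem graft_eq_cons (a b : RTree) : ∃ M : Multiset RTree,
    graft a b = attach a b ::ₘ M ∧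
      ∀ x ∈ M, x.order = a.order + b.order ∧ x.rootDegree = a.rootDegree := by
  induction a using ind with
  | h0 => exact ⟨0, by simp [graft_vertex]⟩
  | h1 a c iha _ =>
    obtain ⟨M, hM, h⟩ := iha
    refine ⟨M.map (fun x => x.attach c) + (graft c b).map (fun x => a.attach x), ?_, ?_⟩
    · rw [graft_attach, hM, Multiset.map_cons, Multiset.cons_add, attach_swap]
    · intro x hx
      rw [Multiset.mem_add, Multiset.mem_map, Multiset.mem_map] at hx
      rcases hx with ⟨y, hy, rfl⟩ | ⟨y, hy, rfl⟩
      · have := h y hy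
        simp only [order_attach, rootDegree_attach]; omega
      · have := order_graft c b y hy
        simp only [order_attach, rootDegree_attach, and_true]; omega

end RTree

/-! ### The free pre-Lie algebra on one generator -/

theorem lin_ind {K ι : Type} [Field K] {P : (ι →₀ K) → Prop} (h0 : P 0)
    (hadd : ∀ x y, P x → P y → P (x + y)) (hsmul : ∀ (c : K) x, P x → P (c • x))
    (h1 : ∀ T, P (Finsupp.single T 1)) (x : ι →₀ K) : P x := by
  induction x using Finsupp.induction_linear with
  | zero => exact h0
  | add f g hf hg => exact hadd _ _ hf hg
  | single T c =>
    have := hsmul c _ (h1 T)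
    rwa [Finsupp.smul_single, smul_eq_mul, mul_one] at this

/-- The free pre-Lie algebra on one generator: the vector space with basis the rooted trees. -/
def PL (K : Type) [Field K] : Type := RTree →₀ K

namespace PL

variable {K : Type} [Field K]

noncomputable instance : AddCommGroup (PL K) := inferInstanceAs (AddCommGroup (RTree →₀ K))

noncomputable instance : Module K (PL K) := inferInstanceAs (Module K (RTree →₀ K))

/-- The basis element given by a rooted tree. -/
noncomputable def tree (T : RTree) : PL K := Finsupp.single T (1 : K)

/-- The linear map with given values on the basis. -/
noncomputable def lift {M : Type} [AddCommGroup M] [Module K M] (f : RTree → M) : PL K →ₗ[K] M :=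
  Finsupp.linearCombination K f

theorem lift_tree {M : Type} [AddCommGroup M] [Module K M] (f : RTree → M) (T : RTree) :
    lift (K := K) f (tree T) = f T := by
  refine (Finsupp.linearCombination_single K (1 : K) T).trans ?_
  rw [one_smul]

theorem ind {P : PL K → Prop} (h0 : P 0)
    (hadd : ∀ x y, P x → P y → P (x + y)) (hsmul : ∀ (c : K) x, P x → P (c • x))
    (h1 : ∀ T, P (tree T)) (x : PL K) : P x :=
  lin_ind (ι := RTree) h0 hadd hsmul h1 x

/-- The pre-Lie product `x ↶ y` on rooted trees. -/
noncomputable def graft : PL K →ₗ[K] PL K →ₗ[K] PL K :=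
  lift fun T => lift fun T' => ((RTree.graft T T').map tree).sum

/-- The rooted tree with one vertex. -/
noncomputable def vertex : PL K := tree RTree.vertex

theorem graft_tree (T T' : RTree) :
    graft (tree T : PL K) (tree T') = ((RTree.graft T T').map tree).sum := by
  rw [graft, lift_tree, lift_tree]

/-- The bilinear extension of `RTree.attach`. -/
noncomputable def attach : PL K →ₗ[K] PL K →ₗ[K] PL K :=
  lift fun T => lift fun T' => tree (RTree.attach T T')

theorem attach_tree (T T' : RTree) :
    attach (tree T : PL K) (tree T') = tree (RTree.attach T T') := by
  rw [attach, lift_tree, lift_tree]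

theorem attach_swap (x y z : PL K) : attach (attach x y) z = attach (attach x z) y := by
  induction x using PL.ind with
  | h0 => simp
  | hadd a b ha hb => simp [ha, hb]
  | hsmul c a ha => simp [ha]
  | h1 T =>
  induction y using PL.ind with
  | h0 => simp
  | hadd a b ha hb => simp [ha, hb]
  | hsmul c a ha => simp [ha]
  | h1 U =>
  induction z using PL.ind with
  | h0 => simp
  | hadd a b ha hb => simp [ha, hb]
  | hsmul c a ha => simp [ha]
  | h1 W => simp only [attach_tree, RTree.attach_swap T U W]

theorem graft_vertex (y : PL K) : graft vertex y = attach vertex y := by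
  induction y using PL.ind with
  | h0 => simp
  | hadd a b ha hb => simp [ha, hb]
  | hsmul c a ha => simp [ha]
  | h1 U => simp [vertex, graft_tree, attach_tree, RTree.graft_vertex]

theorem graft_attach (x y z : PL K) :
    graft (attach x y) z = attach (graft x z) y + attach x (graft y z) := by
  induction x using PL.ind with
  | h0 => simp
  | hadd a b ha hb => simp only [map_add, LinearMap.add_apply, ha, hb]; abel
  | hsmul c a ha => simp [ha]
  | h1 T =>
  induction y using PL.ind with
  | h0 => simp
  | hadd a b ha hb => simp only [map_add, LinearMap.add_apply, ha, hb]; abel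
  | hsmul c a ha => simp [ha]
  | h1 U =>
  induction z using PL.ind with
  | h0 => simp
  | hadd a b ha hb => simp only [map_add, LinearMap.add_apply, ha, hb]; abel
  | hsmul c a ha => simp [ha]
  | h1 W =>
    have h (f : PL K →ₗ[K] PL K) (s : Multiset (PL K)) : f s.sum = (s.map f).sum :=
      map_multiset_sum f s
    have h' (s : Multiset (PL K)) (v : PL K) :
        attach s.sum v = (s.map fun u => attach u v).sum := h (attach.flip v) s
    simp only [attach_tree, graft_tree, RTree.graft_attach, Multiset.map_add,
      Multiset.sum_add, Multiset.map_map, h, h', Function.comp_def]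

/-- The product is a right pre-Lie product. -/
theorem graft_preLie (x y z : PL K) :
    graft (graft x y) z - graft x (graft y z) = graft (graft x z) y - graft x (graft z y) := by
  induction x using PL.ind with
  | h0 => simp
  | hadd a b ha hb =>
    simp only [map_add, LinearMap.add_apply]
    rw [add_sub_add_comm, ha, hb]; abel
  | hsmul c a ha => simp only [map_smul, LinearMap.smul_apply, ← smul_sub, ha]
  | h1 T =>
  induction T using RTree.ind with
  | h0 =>
    change graft (graft vertex y) z - graft vertex (graft y z) =
      graft (graft vertex z) y - graft vertex (graft z y)
    simp only [graft_vertex, graft_attach]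
    rw [attach_swap vertex z y]; abel
  | h1 a b ha hb =>
    simp only [← attach_tree, graft_attach, map_add, LinearMap.add_apply]
    have ea := congrArg (fun u => attach u (tree b)) ha
    have eb := congrArg (fun u => attach (tree a) u) hb
    simp only [map_sub, LinearMap.sub_apply] at ea eb
    rw [sub_eq_iff_eq_add] at ea eb
    rw [ea, eb]; abel

end PL

/-! ### Universal property of the rooted trees -/

section Universal

variable {K V : Type} [Field K] [AddCommGroup V] [Module K V] (p : V →ₗ[K] V →ₗ[K] V)

/-- Sum of `f` over the lists obtained by replacing one entry `u` by `p u y`. -/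
def derivSum (y : V) : (List V → V) → List V → V
  | _, [] => 0
  | f, u :: l => f (p u y :: l) + derivSum y (fun l' => f (u :: l')) l

/-- Auxiliary form of `brace`; the number bounds the recursion depth. -/
def braceAux (v : V) : ℕ → List V → V
  | 0, _ => v
  | _ + 1, [] => v
  | n + 1, y :: l => p (braceAux v n l) y - derivSum p y (braceAux v n) l

/-- The symmetric braces `v{y₁, …, yₖ}` of a pre-Lie algebra. -/
def brace (v : V) (l : List V) : V := braceAux p v l.length l

theorem derivSum_congr (y : V) (l : List V) {f g : List V → V}
    (h : ∀ l', l'.length = l.length → f l' = g l') : derivSum p y f l = derivSum p y g l := by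
  induction l generalizing f g with
  | nil => rfl
  | cons u l ih =>
    simp only [derivSum]
    rw [h (p u y :: l) (by simp), ih]
    intro l' hl'
    exact h _ (by simp [hl'])

theorem brace_nil (v : V) : brace p v [] = v := rfl

theorem brace_cons (v y : V) (l : List V) :
    brace p v (y :: l) = p (brace p v l) y - derivSum p y (brace p v) l := by
  simp only [brace, List.length_cons, braceAux]
  congr 1
  exact derivSum_congr p y l fun l' h => by rw [brace, h]

theorem derivSum_add (y : V) (l : List V) (f g : List V → V) :
    derivSum p y (fun l' => f l' + g l') l = derivSum p y f l + derivSum p y g l := by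
  induction l generalizing f g with
  | nil => simp [derivSum]
  | cons u l ih => simp only [derivSum, ih]; abel

theorem derivSum_sub (y : V) (l : List V) (f g : List V → V) :
    derivSum p y (fun l' => f l' - g l') l = derivSum p y f l - derivSum p y g l := by
  induction l generalizing f g with
  | nil => simp [derivSum]
  | cons u l ih => simp only [derivSum, ih]; abel

theorem derivSum_map (y : V) (l : List V) (f : List V → V) (g : V →ₗ[K] V) :
    derivSum p y (fun l' => g (f l')) l = g (derivSum p y f l) := by
  induction l generalizing f with
  | nil => simp [derivSum]
  | cons u l ih => simp only [derivSum, ih, map_add]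

/-- Additivity in each entry, on lists of length `n`. -/
def AddOn (n : ℕ) (f : List V → V) : Prop :=
  ∀ (l₁ : List V) (x x' : V) (l₂ : List V), l₁.length + l₂.length + 1 = n →
    f (l₁ ++ (x + x') :: l₂) = f (l₁ ++ x :: l₂) + f (l₁ ++ x' :: l₂)

theorem AddOn.cons {n : ℕ} {f : List V → V} (h : AddOn (n + 1) f) (u : V) :
    AddOn n (fun l => f (u :: l)) := by
  intro l₁ x x' l₂ hl
  exact h (u :: l₁) x x' l₂ (by simp only [List.length_cons]; omega)

theorem AddOn.derivSum {n : ℕ} {f : List V → V} (h : AddOn n f) (y : V) :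
    AddOn n (derivSum p y f) := by
  intro l₁
  induction l₁ generalizing n f with
  | nil =>
    intro x x' l₂ hl
    have hf := fun a b => h [] a b l₂ hl
    simp only [List.nil_append] at hf
    simp only [List.nil_append, QOmega.derivSum, map_add, LinearMap.add_apply, hf]
    rw [derivSum_congr p y l₂ (g := fun l' => f (x :: l') + f (x' :: l')), derivSum_add]
    · abel
    · intro l' hl'
      exact h [] x x' l' (by simp_all)
  | cons u l₁ ih =>
    intro x x' l₂ hl
    have e1 := h (p u y :: l₁) x x' l₂ hl
    have e2 := ih (n := l₁.length + l₂.length + 1) (f := fun l => f (u :: l))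
      (AddOn.cons (by convert h using 1; simp only [List.length_cons] at hl; omega) u) x x' l₂ rfl
    simp only [List.cons_append] at e1
    simp only [List.cons_append, QOmega.derivSum, e1, e2]
    abel

theorem derivSum_add_left {f : List V → V} (y y' : V) (l : List V) (h : AddOn l.length f) :
    derivSum p (y + y') f l = derivSum p y f l + derivSum p y' f l := by
  induction l generalizing f with
  | nil => simp [derivSum]
  | cons u l ih =>
    have e := h [] (p u y) (p u y') l (by simp)
    simp only [List.nil_append] at e
    simp only [derivSum, map_add, e, ih (h.cons u)]
    abel

theorem brace_addOn (v : V) (n : ℕ) : AddOn n (brace p v) := by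
  induction n with
  | zero => intro l₁ x x' l₂ h; omega
  | succ n ih =>
    intro l₁ x x' l₂ h
    cases l₁ with
    | nil =>
      have : l₂.length = n := by simpa using h
      subst this
      simp only [List.nil_append, brace_cons, map_add, derivSum_add_left p x x' l₂ ih]
      abel
    | cons u l₁ =>
      have hl : l₁.length + l₂.length + 1 = n := by simp only [List.length_cons] at h; omega
      simp only [List.cons_append, brace_cons, ih l₁ x x' l₂ hl, (ih.derivSum p u) l₁ x x' l₂ hl,
        map_add, LinearMap.add_apply]
      abel

theorem derivSum_symm
    (hp : ∀ x y z, p (p x y) z - p x (p y z) = p (p x z) y - p x (p z y))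
    (s t : V) (l : List V) {f : List V → V} (h : AddOn l.length f) :
    derivSum p (p t s) f l + derivSum p s (derivSum p t f) l =
      derivSum p (p s t) f l + derivSum p t (derivSum p s f) l := by
  induction l generalizing f with
  | nil => simp [derivSum]
  | cons u l ih =>
    have e1 := h [] (p u (p t s)) (p (p u s) t) l (by simp)
    have e2 := h [] (p u (p s t)) (p (p u t) s) l (by simp)
    have e3 : p u (p t s) + p (p u s) t = p u (p s t) + p (p u t) s := by
      have := hp u s t
      rw [sub_eq_iff_eq_add] at this
      rw [this]; abel
    rw [e3, e2] at e1
    simp only [List.nil_append] at e1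
    have e4 := ih (h.cons u)
    simp only [derivSum, derivSum_add]
    calc _ = (f (p u (p t s) :: l) + f (p (p u s) t :: l)) +
          (derivSum p (p t s) (fun l' => f (u :: l')) l +
            derivSum p s (derivSum p t fun l' => f (u :: l')) l) +
          (derivSum p t (fun l' => f (p u s :: l')) l +
            derivSum p s (fun l' => f (p u t :: l')) l) := by abel
      _ = _ := by rw [← e1, e4]; abel

theorem brace_swap
    (hp : ∀ x y z, p (p x y) z - p x (p y z) = p (p x z) y - p x (p z y))
    (v s t : V) (l : List V) : brace p v (s :: t :: l) = brace p v (t :: s :: l) := by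
  have key : ∀ s t : V, brace p v (s :: t :: l) =
      (p (p (brace p v l) t) s - p (brace p v l) (p t s)) -
        (p (derivSum p t (brace p v) l) s + p (derivSum p s (brace p v) l) t) +
        (derivSum p (p t s) (brace p v) l + derivSum p s (derivSum p t (brace p v)) l) := by
    intro s t
    have e : derivSum p s (fun l' => brace p v (t :: l')) l =
        p (derivSum p s (brace p v) l) t - derivSum p s (derivSum p t (brace p v)) l := by
      simp only [brace_cons]
      rw [derivSum_sub]
      congr 1
      exact derivSum_map p s l (brace p v) (p.flip t)
    rw [brace_cons p v s (t :: l)]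
    simp only [derivSum]
    rw [e, brace_cons p v t l, brace_cons p v (p t s) l]
    simp only [map_sub, LinearMap.sub_apply]
    abel
  rw [key s t, key t s, hp, derivSum_symm p hp s t l (brace_addOn p v _)]
  abel

theorem derivSum_perm (y : V) {l l' : List V} (h : l.Perm l') {f : List V → V}
    (hf : ∀ a b : List V, a.length = l.length → a.Perm b → f a = f b) :
    derivSum p y f l = derivSum p y f l' := by
  induction h generalizing f with
  | nil => rfl
  | cons u h ih =>
    simp only [derivSum]
    rw [hf _ _ (by simp) (h.cons _), ih]
    intro a b ha hab
    exact hf _ _ (by simp [ha]) (hab.cons u)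
  | swap a b l =>
    simp only [derivSum]
    rw [hf (p b y :: a :: l) (a :: p b y :: l) (by simp) (.swap _ _ _),
      hf (b :: p a y :: l) (p a y :: b :: l) (by simp) (.swap _ _ _),
      derivSum_congr p y l (g := fun l' => f (a :: b :: l'))]
    · abel
    · intro l' hl'
      exact hf _ _ (by simp [hl']) (.swap _ _ _)
  | trans h1 h2 ih1 ih2 =>
    rw [ih1 hf, ih2]
    intro a b ha hab
    exact hf a b (by rw [ha, h1.length_eq]) hab

theorem brace_perm
    (hp : ∀ x y z, p (p x y) z - p x (p y z) = p (p x z) y - p x (p z y))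
    (v : V) {l l' : List V} (h : l.Perm l') : brace p v l = brace p v l' := by
  suffices H : ∀ n, ∀ a b : List V, a.length = n → a.Perm b → brace p v a = brace p v b from
    H _ l l' rfl h
  intro n
  induction n using Nat.strong_induction_on with
  | _ n ih =>
    intro a b ha hab
    induction hab with
    | nil => rfl
    | cons u h _ =>
      have hn := fun a' b' (h' : a'.length = _) => ih _ (by
        rw [← ha, List.length_cons]; exact Nat.lt_succ_self _) a' b' h'
      rw [brace_cons, brace_cons, hn _ _ rfl h, derivSum_perm p u h hn]
    | swap a b l => exact brace_swap p hp v b a l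
    | trans h1 h2 ih1 ih2 => rw [ih1 ha, ih2 (by rw [← h1.length_eq, ha])]

/-- The values on the subtrees at the root of a planar tree, for the morphism with
`vertex ↦ v`. -/
def branches (v : V) : PlanarTree → List V
  | .vertex => []
  | .attach a b => brace p v (branches v b) :: branches v a

theorem branches_perm
    (hp : ∀ x y z, p (p x y) z - p x (p y z) = p (p x z) y - p x (p z y))
    (v : V) {a b : PlanarTree} (h : a.Swap b) : (branches p v a).Perm (branches p v b) := by
  induction h with
  | swap a b c => exact .swap _ _ _
  | left b _ ih => exact ih.cons _
  | right a _ ih =>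
    simp only [branches]
    rw [brace_perm p hp v ih]

/-- The value on a rooted tree of the morphism with `vertex ↦ v`. -/
def treeValue (hp : ∀ x y z, p (p x y) z - p x (p y z) = p (p x z) y - p x (p z y))
    (v : V) : RTree → V :=
  Quot.lift (fun a => brace p v (branches p v a))
    fun _ _ h => brace_perm p hp v (branches_perm p hp v h)

/-- The values on the subtrees at the root of a rooted tree. -/
def treeBranches (hp : ∀ x y z, p (p x y) z - p x (p y z) = p (p x z) y - p x (p z y))
    (v : V) : RTree → Multiset V :=
  Quot.lift (fun a => (branches p v a : Multiset V))
    fun _ _ h => Multiset.coe_eq_coe.2 (branches_perm p hp v h)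

/-- The symmetric braces as a function on multisets. -/
def mbrace (hp : ∀ x y z, p (p x y) z - p x (p y z) = p (p x z) y - p x (p z y))
    (v : V) : Multiset V → V :=
  Quot.lift (brace p v) fun _ _ h => brace_perm p hp v h

theorem sum_mbrace_graft
    (hp : ∀ x y z, p (p x y) z - p x (p y z) = p (p x z) y - p x (p z y))
    (v : V) (t : RTree) (a : PlanarTree) (c : List V) :
    ((RTree.graft (RTree.mk a) t).map
        fun x => mbrace p hp v (treeBranches p hp v x + (c : Multiset V))).sum =
      brace p v (treeValue p hp v t :: (branches p v a ++ c)) +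
        derivSum p (treeValue p hp v t) (fun l => brace p v (l ++ c)) (branches p v a) := by
  have hm : ∀ l : List V, mbrace p hp v (l : Multiset V) = brace p v l := fun _ => rfl
  have hb : ∀ x : RTree, mbrace p hp v (treeBranches p hp v x) = treeValue p hp v x := by
    intro x; induction x using Quot.ind; rfl
  have ha : ∀ x y : RTree, treeBranches p hp v (x.attach y) =
      treeValue p hp v y ::ₘ treeBranches p hp v x := by
    intro x y; induction x using Quot.ind; induction y using Quot.ind; rfl
  have hbr : ∀ a : PlanarTree, treeBranches p hp v (RTree.mk a) = (branches p v a : Multiset V) :=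
    fun _ => rfl
  induction a generalizing c with
  | vertex =>
    change ((RTree.graft RTree.vertex t).map _).sum = _
    rw [RTree.graft_vertex, Multiset.map_singleton, Multiset.sum_singleton, ha]
    change brace p v (treeValue p hp v t :: ([] ++ c)) = _ + 0
    rw [add_zero]; rfl
  | attach a b iha ihb =>
    have e : RTree.mk (a.attach b) = (RTree.mk a).attach (RTree.mk b) := rfl
    set y := treeValue p hp v t with hy
    set w := brace p v (branches p v b) with hw
    have hwb : treeValue p hp v (RTree.mk b) = w := rfl
    rw [e, RTree.graft_attach, Multiset.map_add, Multiset.sum_add, Multiset.map_map,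
      Multiset.map_map]
    have h1 := iha (w :: c)
    have h2 := ihb []
    simp only [Multiset.coe_nil, add_zero, List.append_nil, hb] at h2
    rw [brace_cons, sub_add_cancel] at h2
    have h3 : ((RTree.graft (RTree.mk b) t).map
        fun x => brace p v (treeValue p hp v x :: (branches p v a ++ c))).sum =
        brace p v (p w y :: (branches p v a ++ c)) := by
      let F : V →+ V := AddMonoidHom.mk' (fun u => brace p v (u :: (branches p v a ++ c)))
        fun x x' => brace_addOn p v _ [] x x' _ rfl
      have := map_multiset_sum F ((RTree.graft (RTree.mk b) t).map (treeValue p hp v))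
      rw [h2, Multiset.map_map] at this
      exact this.symm
    have e1 : ((fun x => mbrace p hp v (treeBranches p hp v x + (c : Multiset V))) ∘
        fun x : RTree => x.attach (RTree.mk b)) =
        fun x => mbrace p hp v (treeBranches p hp v x + ((w :: c : List V) : Multiset V)) := by
      funext x
      simp only [Function.comp, ha, hwb]
      rw [← Multiset.cons_coe, Multiset.cons_add, Multiset.add_cons]
    have e2 : ((fun x => mbrace p hp v (treeBranches p hp v x + (c : Multiset V))) ∘
        fun x : RTree => (RTree.mk a).attach x) =
        fun x => brace p v (treeValue p hp v x :: (branches p v a ++ c)) := by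
      funext x
      simp only [Function.comp, ha, hbr, Multiset.coe_add, Multiset.cons_coe, hm,
        List.cons_append]
    rw [e1, e2, h1, h3]
    have e3 : branches p v (a.attach b) = w :: branches p v a := rfl
    rw [e3]
    simp only [derivSum]
    rw [brace_perm p hp v (l := y :: (branches p v a ++ w :: c))
      (l' := y :: (w :: branches p v a ++ c)) (List.perm_middle.cons y),
      derivSum_congr p y (branches p v a) (g := fun l' => brace p v (w :: l' ++ c))
        fun l' _ => brace_perm p hp v List.perm_middle]
    simp only [List.cons_append]
    abel

theorem PL.hom_ext {φ ψ : PL K →ₗ[K] V} (h0 : φ PL.vertex = ψ PL.vertex)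
    (hφ : ∀ x y, φ (PL.graft x y) = p (φ x) (φ y))
    (hψ : ∀ x y, ψ (PL.graft x y) = p (ψ x) (ψ y)) : φ = ψ := by
  suffices H : ∀ n d (T : RTree), T.order = n → T.rootDegree = d →
      φ (PL.tree T) = ψ (PL.tree T) by
    refine LinearMap.ext fun x => ?_
    induction x using PL.ind with
    | h0 => simp
    | hadd a b ha hb => simp only [map_add, ha, hb]
    | hsmul c a ha => simp only [map_smul, ha]
    | h1 T => exact H _ _ T rfl rfl
  intro n
  induction n using Nat.strong_induction_on with
  | _ n ihn =>
  intro d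
  induction d using Nat.strong_induction_on with
  | _ d ihd =>
  intro T hn hd
  induction T using RTree.ind with
  | h0 => exact h0
  | h1 a b _ _ =>
    rw [RTree.order_attach] at hn
    rw [RTree.rootDegree_attach] at hd
    have pa := a.order_pos
    have pb := b.order_pos
    have ea := ihn a.order (by omega) _ a rfl rfl
    have eb := ihn b.order (by omega) _ b rfl rfl
    obtain ⟨M, hM, h⟩ := RTree.graft_eq_cons a b
    have e := PL.graft_tree (K := K) a b
    rw [hM, Multiset.map_cons, Multiset.sum_cons] at e
    have e1 := hφ (PL.tree a) (PL.tree b)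
    have e2 := hψ (PL.tree a) (PL.tree b)
    rw [e, map_add, map_multiset_sum, Multiset.map_map] at e1 e2
    rw [ea, eb, ← e2] at e1
    have e3 : M.map (φ ∘ PL.tree) =
        M.map (ψ ∘ PL.tree) :=
      Multiset.map_congr rfl fun x hx =>
        ihd a.rootDegree (by omega) x (by rw [(h x hx).1, hn]) (h x hx).2
    rw [e3] at e1
    exact add_right_cancel e1

/-- The rooted trees with the grafting product form the free pre-Lie algebra on the tree with
one vertex. -/
theorem PL.existsUnique_hom
    (hp : ∀ x y z, p (p x y) z - p x (p y z) = p (p x z) y - p x (p z y)) (v : V) :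
    ∃! φ : PL K →ₗ[K] V, φ PL.vertex = v ∧ ∀ x y, φ (PL.graft x y) = p (φ x) (φ y) := by
  refine existsUnique_of_exists_of_unique
    ⟨PL.lift (treeValue p hp v), ?_, ?_⟩
    fun φ ψ h h' => PL.hom_ext p (h.1.trans h'.1.symm) h.2 h'.2
  · simp only [PL.vertex, PL.lift_tree]
    rfl
  · intro x y
    induction x using PL.ind with
    | h0 => simp
    | hadd a b ha hb => simp only [map_add, LinearMap.add_apply, ha, hb]
    | hsmul c a ha => simp only [map_smul, LinearMap.smul_apply, ha]
    | h1 T =>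
    induction y using PL.ind with
    | h0 => simp
    | hadd a b ha hb => simp only [map_add, ha, hb]
    | hsmul c a ha => simp only [map_smul, ha]
    | h1 U =>
      have hb : ∀ x : RTree, mbrace p hp v (treeBranches p hp v x) = treeValue p hp v x := by
        intro x; induction x using Quot.ind; rfl
      induction T using Quot.ind with
      | mk a =>
      have := sum_mbrace_graft p hp v U a []
      simp only [Multiset.coe_nil, add_zero, List.append_nil, hb] at this
      rw [brace_cons, sub_add_cancel] at this
      change PL.lift (treeValue p hp v)
        (PL.graft (PL.tree (RTree.mk a)) _) =
        p (PL.lift (treeValue p hp v) (PL.tree (RTree.mk a))) _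
      rw [PL.graft_tree, map_multiset_sum, Multiset.map_map]
      simp only [Function.comp_def, PL.lift_tree]
      exact this

end Universal

/-! ### The free dendriform algebra on one generator -/

/-- Planar binary trees, including the tree `nil` without inner vertex. -/
abbrev BTree : Type := BinaryTree Unit

/-- Planar binary trees with at least one inner vertex: `(l, r)` is the tree whose root has the
left subtree `l` and the right subtree `r`. -/
abbrev PBTree : Type := BTree × BTree

section Star

variable (K : Type) [Field K]

/-- The associative product of planar binary trees, with unit `nil`:
`(l ∨ r) * (l' ∨ r') = l ∨ (r * (l' ∨ r')) + ((l ∨ r) * l') ∨ r'`. -/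
noncomputable def star : BTree → BTree → (BTree →₀ K)
  | .nil, s => Finsupp.single s 1
  | .node _ l r, .nil => Finsupp.single (.node () l r) 1
  | .node _ l r, .node _ l' r' =>
      Finsupp.mapDomain (fun u => .node () l u) (star r (.node () l' r')) +
      Finsupp.mapDomain (fun u => .node () u r') (star (.node () l r) l')
termination_by t s => t.numNodes + s.numNodes
decreasing_by all_goals simp only [BinaryTree.numNodes]; omega

/-- The bilinear extension of `star`. -/
noncomputable def starL : (BTree →₀ K) →ₗ[K] (BTree →₀ K) →ₗ[K] (BTree →₀ K) :=
  Finsupp.linearCombination K fun t => Finsupp.linearCombination K fun s => star K t s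

/-- The bilinear extension of `(l, r) ↦ l ∨ r`. -/
noncomputable def nodeL : (BTree →₀ K) →ₗ[K] (BTree →₀ K) →ₗ[K] (BTree →₀ K) :=
  Finsupp.linearCombination K fun l => Finsupp.linearCombination K fun r =>
    Finsupp.single (.node () l r) 1

variable {K}

theorem starL_single (t s : BTree) :
    starL K (Finsupp.single t 1) (Finsupp.single s 1) = star K t s := by
  simp [starL]

theorem nodeL_single (l r : BTree) :
    nodeL K (Finsupp.single l 1) (Finsupp.single r 1) = Finsupp.single (.node () l r) 1 := by
  simp [nodeL]

theorem nil_starL (x : BTree →₀ K) : starL K (Finsupp.single .nil 1) x = x := by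
  induction x using lin_ind with
  | h0 => simp
  | hadd a b ha hb => simp only [map_add, ha, hb]
  | hsmul c a ha => simp only [map_smul, ha]
  | h1 T => rw [starL_single, star]

theorem starL_nil (x : BTree →₀ K) : starL K x (Finsupp.single .nil 1) = x := by
  induction x using lin_ind with
  | h0 => simp
  | hadd a b ha hb => simp only [map_add, LinearMap.add_apply, ha, hb]
  | hsmul c a ha => simp only [map_smul, LinearMap.smul_apply, ha]
  | h1 T => cases T <;> rw [starL_single, star]

theorem nodeL_left (l : BTree) (x : BTree →₀ K) :
    nodeL K (Finsupp.single l 1) x = Finsupp.mapDomain (fun u => .node () l u) x := by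
  induction x using lin_ind with
  | h0 => simp
  | hadd a b ha hb => simp only [map_add, ha, hb, Finsupp.mapDomain_add]
  | hsmul c a ha => simp only [map_smul, ha, Finsupp.mapDomain_smul]
  | h1 T => rw [nodeL_single, Finsupp.mapDomain_single]

theorem nodeL_right (r : BTree) (x : BTree →₀ K) :
    nodeL K x (Finsupp.single r 1) = Finsupp.mapDomain (fun u => .node () u r) x := by
  induction x using lin_ind with
  | h0 => simp
  | hadd a b ha hb => simp only [map_add, LinearMap.add_apply, ha, hb, Finsupp.mapDomain_add]
  | hsmul c a ha => simp only [map_smul, LinearMap.smul_apply, ha, Finsupp.mapDomain_smul]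
  | h1 T => rw [nodeL_single, Finsupp.mapDomain_single]

theorem starL_nodeL (x y x' y' : BTree →₀ K) :
    starL K (nodeL K x y) (nodeL K x' y') =
      nodeL K x (starL K y (nodeL K x' y')) + nodeL K (starL K (nodeL K x y) x') y' := by
  induction x using lin_ind with
  | h0 => simp
  | hadd a b ha hb => simp only [map_add, LinearMap.add_apply, ha, hb]; abel
  | hsmul c a ha => simp only [map_smul, LinearMap.smul_apply, ha, smul_add]
  | h1 l =>
  induction y using lin_ind with
  | h0 => simp
  | hadd a b ha hb => simp only [map_add, LinearMap.add_apply, ha, hb]; abel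
  | hsmul c a ha => simp only [map_smul, LinearMap.smul_apply, ha, smul_add]
  | h1 r =>
  induction x' using lin_ind with
  | h0 => simp
  | hadd a b ha hb => simp only [map_add, LinearMap.add_apply, ha, hb]; abel
  | hsmul c a ha => simp only [map_smul, LinearMap.smul_apply, ha, smul_add]
  | h1 l' =>
  induction y' using lin_ind with
  | h0 => simp
  | hadd a b ha hb => simp only [map_add, ha, hb]; abel
  | hsmul c a ha => simp only [map_smul, ha, smul_add]
  | h1 r' =>
    rw [nodeL_single, nodeL_single, starL_single, star, starL_single, starL_single, nodeL_left,
      nodeL_right]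

theorem starL_assoc (x y z : BTree →₀ K) :
    starL K (starL K x y) z = starL K x (starL K y z) := by
  induction x using lin_ind with
  | h0 => simp
  | hadd a b ha hb => simp only [map_add, LinearMap.add_apply, ha, hb]
  | hsmul c a ha => simp only [map_smul, LinearMap.smul_apply, ha]
  | h1 a =>
  induction y using lin_ind with
  | h0 => simp
  | hadd a b ha hb => simp only [map_add, LinearMap.add_apply, ha, hb]
  | hsmul c a ha => simp only [map_smul, LinearMap.smul_apply, ha]
  | h1 b =>
  induction z using lin_ind with
  | h0 => simp
  | hadd a b ha hb => simp only [map_add, ha, hb]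
  | hsmul c a ha => simp only [map_smul, ha]
  | h1 c =>
  induction a generalizing c with
  | nil => rw [nil_starL, nil_starL]
  | node _ l r _ ihr =>
  cases b with
  | nil => rw [nil_starL, starL_nil]
  | node _ l' r' =>
  induction c with
  | nil => rw [starL_nil, starL_nil]
  | node _ l'' r'' ihl =>
    have h1 := ihr (.node () l'' r'')
    have e (v : Unit) (l r : BTree) : (Finsupp.single (.node v l r) 1 : BTree →₀ K) =
      nodeL K (Finsupp.single l 1) (Finsupp.single r 1) := (nodeL_single l r).symm
    simp only [e] at h1 ihl ⊢
    clear ihr e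
    generalize Finsupp.single l (1 : K) = l at *
    generalize Finsupp.single r (1 : K) = r at *
    generalize Finsupp.single l' (1 : K) = l' at *
    generalize Finsupp.single r' (1 : K) = r' at *
    generalize Finsupp.single l'' (1 : K) = l'' at *
    generalize Finsupp.single r'' (1 : K) = r'' at *
    have e1 := starL_nodeL l r l' r'
    have e2 := starL_nodeL l' r' l'' r''
    calc _ = nodeL K l (starL K (starL K r (nodeL K l' r')) (nodeL K l'' r'')) +
          nodeL K (starL K (nodeL K l r) l') (starL K r' (nodeL K l'' r'')) +
          nodeL K (starL K (starL K (nodeL K l r) (nodeL K l' r')) l'') r'' := by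
            rw [e1]
            simp only [map_add, LinearMap.add_apply]
            rw [starL_nodeL, starL_nodeL]
            abel
      _ = _ := by
            rw [h1, ihl, e2]
            simp only [map_add]
            rw [starL_nodeL, starL_nodeL]
            abel

end Star

/-- The free dendriform algebra on one generator: the vector space with basis the planar binary
trees with at least one inner vertex. -/
def Dend (K : Type) [Field K] : Type := PBTree →₀ K

namespace Dend

variable {K : Type} [Field K]

noncomputable instance : AddCommGroup (Dend K) := inferInstanceAs (AddCommGroup (PBTree →₀ K))

noncomputable instance : Module K (Dend K) := inferInstanceAs (Module K (PBTree →₀ K))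

/-- The basis element `l ∨ r`. -/
noncomputable def tree (l r : BTree) : Dend K := Finsupp.single ((l, r) : PBTree) (1 : K)

/-- The linear map with given values on the basis. -/
noncomputable def lift {M : Type} [AddCommGroup M] [Module K M] (f : BTree → BTree → M) :
    Dend K →ₗ[K] M :=
  Finsupp.linearCombination K (fun t : PBTree => f t.1 t.2)

theorem lift_tree {M : Type} [AddCommGroup M] [Module K M] (f : BTree → BTree → M)
    (l r : BTree) : lift (K := K) f (tree l r) = f l r := by
  refine (Finsupp.linearCombination_single K (1 : K) ((l, r) : PBTree)).trans ?_
  rw [one_smul]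

theorem ind {P : Dend K → Prop} (h0 : P 0)
    (hadd : ∀ x y, P x → P y → P (x + y)) (hsmul : ∀ (c : K) x, P x → P (c • x))
    (h1 : ∀ l r, P (tree l r)) (x : Dend K) : P x :=
  lin_ind (ι := PBTree) h0 hadd hsmul (fun T => h1 T.1 T.2) x

/-- The bilinear extension of `(l, r) ↦ l ∨ r`. -/
noncomputable def join : (BTree →₀ K) →ₗ[K] (BTree →₀ K) →ₗ[K] Dend K :=
  Finsupp.linearCombination K fun l => Finsupp.linearCombination K fun r => tree l r

/-- The inclusion into the vector space on all planar binary trees. -/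
noncomputable def incl : Dend K →ₗ[K] (BTree →₀ K) :=
  lift fun l r => Finsupp.single (.node () l r) 1

/-- The product `≺`, with `(l ∨ r) ≺ s = l ∨ (r * s)`. -/
noncomputable def prec : Dend K →ₗ[K] Dend K →ₗ[K] Dend K :=
  lift fun l r => join (Finsupp.single l 1) ∘ₗ starL K (Finsupp.single r 1) ∘ₗ incl

/-- The product `≻`, with `s ≻ (l ∨ r) = (s * l) ∨ r`. -/
noncomputable def succ : Dend K →ₗ[K] Dend K →ₗ[K] Dend K :=
  LinearMap.flip <| lift fun l r =>
    join.flip (Finsupp.single r 1) ∘ₗ (starL K).flip (Finsupp.single l 1) ∘ₗ incl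

theorem join_single (l r : BTree) :
    join (Finsupp.single l (1 : K)) (Finsupp.single r 1) = tree l r := by
  simp [join]

theorem join_ind {P : Dend K → Prop} (h0 : P 0)
    (hadd : ∀ x y, P x → P y → P (x + y)) (hsmul : ∀ (c : K) x, P x → P (c • x))
    (h1 : ∀ l r, P (join l r)) (x : Dend K) : P x :=
  ind h0 hadd hsmul (fun l r => by rw [← join_single]; exact h1 _ _) x

theorem incl_join (x y : BTree →₀ K) : incl (join x y) = nodeL K x y := by
  induction x using lin_ind with
  | h0 => simp
  | hadd a b ha hb => simp only [map_add, LinearMap.add_apply, ha, hb]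
  | hsmul c a ha => simp only [map_smul, LinearMap.smul_apply, ha]
  | h1 l =>
  induction y using lin_ind with
  | h0 => simp
  | hadd a b ha hb => simp only [map_add, ha, hb]
  | hsmul c a ha => simp only [map_smul, ha]
  | h1 r => rw [join_single, incl, lift_tree, nodeL_single]

theorem prec_join (x y : BTree →₀ K) (z : Dend K) :
    prec (join x y) z = join x (starL K y (incl z)) := by
  induction x using lin_ind with
  | h0 => simp
  | hadd a b ha hb => simp only [map_add, LinearMap.add_apply, ha, hb]
  | hsmul c a ha => simp only [map_smul, LinearMap.smul_apply, ha]
  | h1 l =>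
  induction y using lin_ind with
  | h0 => simp
  | hadd a b ha hb => simp only [map_add, LinearMap.add_apply, ha, hb]
  | hsmul c a ha => simp only [map_smul, LinearMap.smul_apply, ha]
  | h1 r => rw [join_single, prec, lift_tree]; rfl

theorem succ_join (z : Dend K) (x y : BTree →₀ K) :
    succ z (join x y) = join (starL K (incl z) x) y := by
  induction x using lin_ind with
  | h0 => simp
  | hadd a b ha hb => simp only [map_add, LinearMap.add_apply, ha, hb]
  | hsmul c a ha => simp only [map_smul, LinearMap.smul_apply, ha]
  | h1 l =>
  induction y using lin_ind with
  | h0 => simp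
  | hadd a b ha hb => simp only [map_add, ha, hb]
  | hsmul c a ha => simp only [map_smul, ha]
  | h1 r => rw [join_single, succ, LinearMap.flip_apply, lift_tree]; rfl

theorem incl_prec_add_succ (x y : Dend K) :
    incl (prec x y + succ x y) = starL K (incl x) (incl y) := by
  induction x using join_ind with
  | h0 => simp
  | hadd a b ha hb =>
    simp only [map_add, LinearMap.add_apply] at ha hb ⊢
    rw [← ha, ← hb]; abel
  | hsmul c a ha => simp only [map_smul, LinearMap.smul_apply, ← smul_add, ha]
  | h1 l r =>
  induction y using join_ind with
  | h0 => simp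
  | hadd a b ha hb =>
    simp only [map_add] at ha hb ⊢
    rw [← ha, ← hb]; abel
  | hsmul c a ha => simp only [map_smul, ← smul_add, ha]
  | h1 l' r' => rw [prec_join, succ_join, map_add]; simp only [incl_join, starL_nodeL]

/-! The three axioms of dendriform algebras. -/

theorem prec_prec (x y z : Dend K) :
    prec x (prec y z) + prec x (succ y z) = prec (prec x y) z := by
  rw [← map_add]
  induction x using join_ind with
  | h0 => simp
  | hadd a b ha hb => simp only [map_add, LinearMap.add_apply] at ha hb ⊢; rw [← ha, ← hb]; abel
  | hsmul c a ha => simp only [map_smul, LinearMap.smul_apply, ha]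
  | h1 l r => rw [prec_join, prec_join, prec_join, incl_prec_add_succ, starL_assoc]

theorem succ_prec (x y z : Dend K) : succ x (prec y z) = prec (succ x y) z := by
  induction y using join_ind with
  | h0 => simp
  | hadd a b ha hb => simp only [map_add, LinearMap.add_apply, ha, hb]
  | hsmul c a ha => simp only [map_smul, LinearMap.smul_apply, ha]
  | h1 l r => rw [prec_join, succ_join, succ_join, prec_join]

theorem succ_succ (x y z : Dend K) :
    succ x (succ y z) = succ (succ x y) z + succ (prec x y) z := by
  rw [← LinearMap.add_apply, ← map_add, add_comm]
  induction z using join_ind with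
  | h0 => simp
  | hadd a b ha hb => simp only [map_add] at ha hb ⊢; rw [ha, hb]
  | hsmul c a ha => simp only [map_smul, ha]
  | h1 l r => rw [succ_join, succ_join, succ_join, incl_prec_add_succ, starL_assoc]

/-- The associative product `x * y = x ≻ y + x ≺ y`. -/
noncomputable instance : Mul (Dend K) := ⟨fun x y => succ x y + prec x y⟩

theorem mul_def (x y : Dend K) : x * y = succ x y + prec x y := rfl

noncomputable instance : NonUnitalRing (Dend K) where
  left_distrib x y z := by simp only [mul_def, map_add]; abel
  right_distrib x y z := by simp only [mul_def, map_add, LinearMap.add_apply]; abel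
  zero_mul x := by simp [mul_def]
  mul_zero x := by simp [mul_def]
  mul_assoc x y z := by
    simp only [mul_def, map_add, LinearMap.add_apply]
    rw [succ_succ, ← prec_prec, succ_prec]
    abel

instance : IsScalarTower K (Dend K) (Dend K) where
  smul_assoc c x y := by
    simp only [smul_eq_mul, mul_def, map_smul, LinearMap.smul_apply, smul_add]

instance : SMulCommClass K (Dend K) (Dend K) where
  smul_comm c x y := by
    simp only [smul_eq_mul, mul_def, map_smul, smul_add]

/-- The pre-Lie product `x ↶ y = y ≻ x - x ≺ y`. -/
noncomputable def preLie : Dend K →ₗ[K] Dend K →ₗ[K] Dend K := succ.flip - prec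

theorem preLie_apply (x y : Dend K) : preLie x y = succ y x - prec x y := rfl

theorem preLie_axiom (x y z : Dend K) :
    preLie (preLie x y) z - preLie x (preLie y z) =
      preLie (preLie x z) y - preLie x (preLie z y) := by
  simp only [preLie_apply, map_sub, LinearMap.sub_apply]
  rw [succ_succ z y x, succ_succ y z x, ← prec_prec x y z, ← prec_prec x z y, succ_prec, succ_prec]
  abel

/-- The planar binary tree with one inner vertex. -/
noncomputable def Y : Dend K := tree .nil .nil

end Dend

/-- The unique morphism of pre-Lie algebras from rooted trees to `Dend` that maps the rooted tree
with one vertex to the planar binary tree with one inner vertex. -/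
noncomputable def phi (K : Type) [Field K] : PL K →ₗ[K] Dend K :=
  (PL.existsUnique_hom (K := K) Dend.preLie Dend.preLie_axiom Dend.Y).choose

/-! ### The completed free pre-Lie algebra and the series `Ω` and `Ω_q` -/

section Completion

variable {K : Type} [Field K]

/-- The homogeneous component of degree `n`, spanned by the rooted trees with `n` vertices. -/
noncomputable def PL.deg (K : Type) [Field K] (n : ℕ) : Submodule K (PL K) :=
  Submodule.span K (PL.tree '' {T : RTree | T.order = n})

/-- The completion: the product of the homogeneous components. (The one of degree `0` is zero.) -/
abbrev PLhat (K : Type) [Field K] : Type := ∀ n : ℕ, PL.deg K n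

theorem PL.tree_mem_deg (T : RTree) : (PL.tree T : PL K) ∈ PL.deg K T.order :=
  Submodule.subset_span ⟨T, rfl, rfl⟩

theorem PL.vertex_mem_deg : (PL.vertex : PL K) ∈ PL.deg K 1 := by
  rw [← RTree.order_vertex]
  exact PL.tree_mem_deg _

theorem PL.graft_mem_deg {m n : ℕ} {x y : PL K} (hx : x ∈ PL.deg K m) (hy : y ∈ PL.deg K n) :
    PL.graft x y ∈ PL.deg K (m + n) := by
  unfold PL.deg at hx hy
  induction hx, hy using Submodule.span_induction₂ with
  | mem_mem x y hx hy =>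
    obtain ⟨T, rfl, rfl⟩ := hx
    obtain ⟨U, rfl, rfl⟩ := hy
    rw [PL.graft_tree]
    refine multiset_sum_mem _ fun a ha => ?_
    obtain ⟨W, hW, rfl⟩ := Multiset.mem_map.1 ha
    rw [← RTree.order_graft T U W hW]
    exact PL.tree_mem_deg W
  | zero_left y hy => simp
  | zero_right x hx => simp
  | add_left x y z _ _ _ h1 h2 =>
    rw [map_add, LinearMap.add_apply]; exact Submodule.add_mem _ h1 h2
  | add_right x y z _ _ _ h1 h2 => rw [map_add]; exact Submodule.add_mem _ h1 h2
  | smul_left r x y _ _ h =>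
    rw [map_smul, LinearMap.smul_apply]; exact Submodule.smul_mem _ _ h
  | smul_right r x y _ _ h => rw [map_smul]; exact Submodule.smul_mem _ _ h

theorem PLhat.zero_eq (x : PL.deg K 0) : x = 0 := by
  have h : {T : RTree | T.order = 0} = ∅ :=
    Set.eq_empty_of_forall_notMem fun T hT => T.order_pos.ne' hT
  obtain ⟨x, hx⟩ := x
  rw [PL.deg, h, Set.image_empty, Submodule.span_empty] at hx
  exact Subtype.ext ((Submodule.mem_bot K).1 hx)

namespace PLhat

/-- The series consisting of the tree with one vertex. -/
noncomputable def vertex : PLhat K := Pi.single 1 ⟨PL.vertex, PL.vertex_mem_deg⟩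

/-- The pre-Lie product `A ↶ B` of series. -/
noncomputable def graft (A B : PLhat K) : PLhat K := fun n =>
  ⟨∑ p ∈ Finset.HasAntidiagonal.antidiagonal n, PL.graft (A p.1 : PL K) (B p.2 : PL K),
    Submodule.sum_mem _ fun p hp => by
      have := PL.graft_mem_deg (A p.1).2 (B p.2).2
      rwa [Finset.HasAntidiagonal.mem_antidiagonal.1 hp] at this⟩

/-- The right action `x ↶ f(A)` of the element `f(A) = ∑ₖ fₖ A^k` of the completed enveloping
algebra, that is `∑ₖ fₖ ((x ↶ A) ↶ ⋯ ↶ A)` with `k` factors `A`. The `k`-th summand starts in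
degree at least `k`, so that the sum is finite in each degree. -/
noncomputable def act (f : PowerSeries K) (A x : PLhat K) : PLhat K := fun n =>
  ∑ k ∈ Finset.range (n + 1), f.coeff k • ((fun z => graft z A)^[k] x) n

/-- The `q`-shift `A[q] = ∑ₙ qⁿ Aₙ`. -/
noncomputable def shift (q : K) (A : PLhat K) : PLhat K := fun n => q ^ n • A n

/-- The suspension `∑ₙ (-1)ⁿ⁻¹ Aₙ`. -/
noncomputable def suspension (A : PLhat K) : PLhat K := fun n => (-1 : K) ^ (n + 1) • A n

theorem graft_congr {A A' B B' : PLhat K} {n : ℕ} (hA : ∀ m < n, A m = A' m)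
    (hB : ∀ m < n, B m = B' m) : graft A B n = graft A' B' n := by
  refine Subtype.ext ?_
  simp only [graft]
  refine Finset.sum_congr rfl fun p hp => ?_
  have hp := Finset.HasAntidiagonal.mem_antidiagonal.1 hp
  rcases Nat.eq_zero_or_pos p.1 with h | h
  · have e (C : PLhat K) : ((C p.1 : PL.deg K p.1) : PL K) = 0 := by
      rw [h, zero_eq (C 0)]; rfl
    rw [e A, e A']; simp
  rcases Nat.eq_zero_or_pos p.2 with h' | h'
  · have e (C : PLhat K) : ((C p.2 : PL.deg K p.2) : PL K) = 0 := by
      rw [h', zero_eq (C 0)]; rfl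
    rw [e B, e B']; simp
  rw [hA p.1 (by omega), hB p.2 (by omega)]

theorem iterate_congr {A B x y : PLhat K} {n : ℕ} (hA : ∀ m < n, A m = B m)
    (hx : ∀ m < n, x m = y m) (k : ℕ) :
    ∀ m < n, ((fun z => graft z A)^[k] x) m = ((fun z => graft z B)^[k] y) m := by
  induction k with
  | zero => exact hx
  | succ k ih =>
    intro m hm
    rw [Function.iterate_succ_apply', Function.iterate_succ_apply']
    exact graft_congr (fun i hi => ih i (hi.trans hm)) (fun i hi => hA i (hi.trans hm))

theorem iterate_congr' {A B x y : PLhat K} {n : ℕ} (hA : ∀ m < n, A m = B m)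
    (hx : ∀ m < n, x m = y m) {k : ℕ} (hk : k ≠ 0) :
    ((fun z => graft z A)^[k] x) n = ((fun z => graft z B)^[k] y) n := by
  obtain ⟨k, rfl⟩ := Nat.exists_eq_succ_of_ne_zero hk
  rw [Function.iterate_succ_apply', Function.iterate_succ_apply']
  exact graft_congr (iterate_congr hA hx k) hA

end PLhat

/-- A recursion that determines each component from the previous ones has a unique solution. -/
theorem existsUnique_fixed {M : ℕ → Type} [∀ n, Inhabited (M n)]
    (F : (∀ n, M n) → ∀ n, M n)
    (hF : ∀ n (A B : ∀ n, M n), (∀ m < n, A m = B m) → F A n = F B n) : ∃! A, F A = A := by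
  let G : ∀ n, (∀ m, m < n → M m) → M n :=
    fun n f => F (fun m => if h : m < n then f m h else default) n
  let A : ∀ n, M n := fun n => Nat.strongRecOn n G
  have hA : ∀ n, A n = F A n := by
    intro n
    have : A n = G n fun m _ => A m := Nat.strongRecOn_eq _ _
    rw [this]
    refine hF n _ _ fun m hm => ?_
    simp [hm]
  refine ⟨A, funext fun n => (hA n).symm, fun B hB => funext fun n => ?_⟩
  induction n using Nat.strong_induction_on with
  | _ n ih => rw [← hB, hA n]; exact hF n _ _ ih

variable (K) in
/-- There is a unique series `Ω` with `∙ ↶ (Ω / (exp Ω - 1)) = Ω`. -/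
theorem existsUnique_Omega [Algebra ℚ K] :
    ∃! A : PLhat K, PLhat.act (bernoulliPowerSeries K) A PLhat.vertex = A := by
  refine existsUnique_fixed _ fun n A B h => Finset.sum_congr rfl fun k _ => ?_
  congr 1
  rcases eq_or_ne k 0 with rfl | hk
  · rfl
  · exact PLhat.iterate_congr' h (fun _ _ => rfl) hk

variable (K) in
/-- The series `Ω`. -/
noncomputable def Omega [Algebra ℚ K] : PLhat K := (existsUnique_Omega K).choose

/-- There is a unique series `Ω_q` with
`Ω_q[q] ↶ (exp Ω - 1) + Ω_q[q] - Ω_q = ∙ ↶ Ω_q + (q - 1) ∙`. -/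
theorem existsUnique_OmegaQ [Algebra ℚ K] {q : K} (hq : ∀ n : ℕ, 0 < n → q ^ n ≠ 1) :
    ∃! A : PLhat K,
      PLhat.act (PowerSeries.exp K - 1) (Omega K) (PLhat.shift q A) + PLhat.shift q A - A =
        PLhat.graft PLhat.vertex A + (q - 1) • PLhat.vertex := by
  have H := existsUnique_fixed (M := fun n => PL.deg K n) (fun (A : PLhat K) n =>
    (q ^ n - 1)⁻¹ • ((PLhat.graft PLhat.vertex A + (q - 1) • PLhat.vertex : PLhat K) n -
      PLhat.act (PowerSeries.exp K - 1) (Omega K) (PLhat.shift q A) n)) (by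
    intro n A B h
    simp only [Pi.add_apply]
    rw [PLhat.graft_congr (fun _ _ => rfl) h]
    congr 2
    refine Finset.sum_congr rfl fun k _ => ?_
    rcases eq_or_ne k 0 with rfl | hk
    · simp
    · rw [PLhat.iterate_congr' (fun _ _ => rfl) (fun m hm => ?_) hk]
      simp only [PLhat.shift, h m hm])
  refine (existsUnique_congr fun A => ?_).1 H
  rw [funext_iff, funext_iff]
  refine forall_congr' fun n => ?_
  rcases Nat.eq_zero_or_pos n with rfl | hn
  · exact iff_of_true ((PLhat.zero_eq _).trans (PLhat.zero_eq _).symm)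
      ((PLhat.zero_eq _).trans (PLhat.zero_eq _).symm)
  have h0 : q ^ n - 1 ≠ 0 := sub_ne_zero.2 (hq n hn)
  have e : (q ^ n - 1) • A n = q ^ n • A n - A n := by rw [sub_smul, one_smul]
  refine (inv_smul_eq_iff₀ h0).trans ?_
  refine (Eq.congr_right e).trans ?_
  simp only [Pi.add_apply, Pi.sub_apply, PLhat.shift]
  constructor
  · intro h; rw [sub_eq_iff_eq_add] at h; rw [h]; abel
  · intro h; rw [← h]; abel

end Completion

/-- The field `ℚ(q)` of rational functions in the indeterminate `q`. -/
abbrev Qq : Type := RatFunc ℚ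

/-- The indeterminate `q`. -/
noncomputable abbrev q : Qq := RatFunc.X

theorem q_pow_ne_one (n : ℕ) (hn : 0 < n) : q ^ n ≠ 1 := by
  intro h
  have h1 : (algebraMap (Polynomial ℚ) Qq) (Polynomial.X ^ n) = algebraMap (Polynomial ℚ) Qq 1 := by
    rw [map_pow, RatFunc.algebraMap_X, map_one]; exact h
  have h2 := congrArg Polynomial.natDegree (RatFunc.algebraMap_injective ℚ h1)
  rw [Polynomial.natDegree_X_pow, Polynomial.natDegree_one] at h2
  omega

/-- The series `Ω_q`, with coefficients in `ℚ(q)`. -/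
noncomputable def OmegaQ : PLhat Qq := (existsUnique_OmegaQ q_pow_ne_one).choose

/-! ### Noncommutative symmetric functions -/

/-- The algebra `Sym`: the free unital associative algebra on `S₁, S₂, …`. The generator with
index `n : ℕ` is `S_{n+1}`. -/
abbrev Sym (K : Type) [Field K] : Type := FreeAlgebra K ℕ

namespace Sym

variable (K : Type) [Field K]

/-- The elements `Sₙ`, with `S₀ = 1`. -/
noncomputable def S : ℕ → Sym K
  | 0 => 1
  | n + 1 => FreeAlgebra.ι K n

/-- The elements `Ψₙ`, determined by `n Sₙ = ∑_{0 ≤ i < n} Sᵢ Ψₙ₋ᵢ` for `n ≥ 1`;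
by convention `Ψ₀ = 0`. -/
noncomputable def Psi (n : ℕ) : Sym K :=
  (n : K) • S K n - ∑ j : Fin n, S K (n - j) * Psi j
termination_by n
decreasing_by exact j.2

theorem Psi_zero : Psi K 0 = 0 := by
  rw [Psi]; simp

theorem smul_S (n : ℕ) : (n : K) • S K n = ∑ i ∈ Finset.range n, S K i * Psi K (n - i) := by
  rcases n with _ | n
  · simp
  have h : (↑(n + 1) : K) • S K (n + 1) =
      Psi K (n + 1) + ∑ j ∈ Finset.range (n + 1), S K (n + 1 - j) * Psi K j := by
    rw [Psi, ← Fin.sum_univ_eq_sum_range (fun j => S K (n + 1 - j) * Psi K j), sub_add_cancel]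
  rw [h, Finset.sum_range_succ' (fun j => S K (n + 1 - j) * Psi K j), Psi_zero, mul_zero, add_zero,
    Finset.sum_range_succ', add_comm, ← Finset.sum_range_reflect]
  congr 1
  · refine Finset.sum_congr rfl fun j hj => ?_
    have := Finset.mem_range.1 hj
    congr 2 <;> omega
  · simp [S]

variable {K}

/-- The elements `Sₙ(A/(1-q))`. Their generating series is the infinite product
`⋯ σ(q² t) σ(q t) σ(t)`, where `σ(t) = ∑ₙ Sₙ tⁿ`; equivalently, `S₀(A/(1-q)) = 1` and
`Sₙ(A/(1-q)) = ∑_{i + j = n} qⁱ Sᵢ(A/(1-q)) Sⱼ`, which is solved here for the term `i = n`. -/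
noncomputable def Sq (q : K) : ℕ → Sym K
  | 0 => 1
  | n + 1 => (1 - q ^ (n + 1))⁻¹ • ∑ i : Fin (n + 1), q ^ (i : ℕ) • (Sq q i * S K (n + 1 - i))
termination_by n => n
decreasing_by exact i.2

theorem Sq_eq {q : K} (hq : ∀ n : ℕ, 0 < n → q ^ n ≠ 1) (n : ℕ) :
    Sq q n = ∑ p ∈ Finset.HasAntidiagonal.antidiagonal n, q ^ p.1 • (Sq q p.1 * S K p.2) := by
  rcases n with _ | n
  · simp [Sq, S]
  have h0 : 1 - q ^ (n + 1) ≠ 0 := sub_ne_zero.2 (hq _ n.succ_pos).symm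
  have h : (1 - q ^ (n + 1)) • Sq q (n + 1) =
      ∑ i ∈ Finset.range (n + 1), q ^ i • (Sq q i * S K (n + 1 - i)) := by
    rw [Sq, smul_inv_smul₀ h0,
      Fin.sum_univ_eq_sum_range (fun i => q ^ i • (Sq q i * S K (n + 1 - i)))]
  rw [Finset.Nat.sum_antidiagonal_eq_sum_range_succ (fun i j => q ^ i • (Sq q i * S K j)),
    Finset.sum_range_succ, ← h, sub_smul, one_smul, Nat.sub_self, S, mul_one, sub_add_cancel]

/-- The change of alphabet `A ↦ A/(1-q)`: the morphism of algebras with `Sₙ ↦ Sₙ(A/(1-q))`. -/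
noncomputable def changeAlphabet (q : K) : Sym K →ₐ[K] Sym K :=
  FreeAlgebra.lift K fun n => Sq q (n + 1)

/-- The elements `Ψₙ(A/(1-q))`. -/
noncomputable def PsiQ (q : K) (n : ℕ) : Sym K := changeAlphabet q (Psi K n)

theorem changeAlphabet_S (q : K) (n : ℕ) : changeAlphabet q (S K n) = Sq q n := by
  cases n with
  | zero => simp [S, Sq]
  | succ n => simp [S, changeAlphabet]

/-- The relation `∑ Ψₙ(A/(1-q)) = (∑ Sₙ)⁻¹ (∑ qⁿ Ψₙ(A/(1-q))) (∑ Sₙ) + ∑ Ψₙ`, multiplied by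
`∑ Sₙ` from the left. -/
theorem PsiQ_eq {q : K} (hq : ∀ n : ℕ, 0 < n → q ^ n ≠ 1) (n : ℕ) :
    ∑ p ∈ Finset.HasAntidiagonal.antidiagonal n, S K p.1 * PsiQ q p.2 =
      ∑ p ∈ Finset.HasAntidiagonal.antidiagonal n, q ^ p.1 • (PsiQ q p.1 * S K p.2) +
        ∑ p ∈ Finset.HasAntidiagonal.antidiagonal n, S K p.1 * Psi K p.2 := by
  have hS (n : ℕ) : (n : K) • S K n =
      ∑ p ∈ Finset.HasAntidiagonal.antidiagonal n, S K p.1 * Psi K p.2 := by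
    rw [smul_S, Finset.Nat.sum_antidiagonal_eq_sum_range_succ (fun i j => S K i * Psi K j),
      Finset.sum_range_succ, Nat.sub_self, Psi_zero, mul_zero, add_zero]
  have hQ (n : ℕ) : (n : K) • Sq q n =
      ∑ p ∈ Finset.HasAntidiagonal.antidiagonal n, Sq q p.1 * PsiQ q p.2 := by
    have := congrArg (changeAlphabet q) (hS n)
    simpa only [map_smul, map_sum, map_mul, changeAlphabet_S, PsiQ] using this
  let s : PowerSeries (Sym K) := PowerSeries.mk (S K)
  let p : PowerSeries (Sym K) := PowerSeries.mk (Psi K)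
  let sq : PowerSeries (Sym K) := PowerSeries.mk (Sq q)
  let pq : PowerSeries (Sym K) := PowerSeries.mk (PsiQ q)
  let sh : PowerSeries (Sym K) → PowerSeries (Sym K) :=
    fun f => PowerSeries.mk fun n => q ^ n • f.coeff n
  let D : PowerSeries (Sym K) → PowerSeries (Sym K) :=
    fun f => PowerSeries.mk fun n => (n : K) • f.coeff n
  have D_mul (f g : PowerSeries (Sym K)) : D (f * g) = D f * g + f * D g := by
    ext n
    simp only [D, PowerSeries.coeff_mk, map_add, PowerSeries.coeff_mul, Finset.smul_sum,
      ← Finset.sum_add_distrib]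
    refine Finset.sum_congr rfl fun x hx => ?_
    rw [← Finset.HasAntidiagonal.mem_antidiagonal.1 hx, Nat.cast_add, add_smul, smul_mul_assoc,
      mul_smul_comm]
  have sh_mul (f g : PowerSeries (Sym K)) : sh (f * g) = sh f * sh g := by
    ext n
    simp only [sh, PowerSeries.coeff_mk, PowerSeries.coeff_mul, Finset.smul_sum]
    refine Finset.sum_congr rfl fun x hx => ?_
    rw [← Finset.HasAntidiagonal.mem_antidiagonal.1 hx, pow_add, smul_mul_smul_comm]
  have D_sh (f : PowerSeries (Sym K)) : D (sh f) = sh (D f) := by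
    ext n
    simp only [D, sh, PowerSeries.coeff_mk]
    rw [smul_comm]
  have h1 : D s = s * p := by
    ext n
    simp only [D, s, p, PowerSeries.coeff_mk, PowerSeries.coeff_mul, hS]
  have h2 : D sq = sq * pq := by
    ext n
    simp only [D, sq, pq, PowerSeries.coeff_mk, PowerSeries.coeff_mul, hQ]
  have h3 : sq = sh sq * s := by
    ext n
    simp only [sh, s, sq, PowerSeries.coeff_mk, PowerSeries.coeff_mul, smul_mul_assoc]
    exact Sq_eq hq n
  have h4 : sh sq * (s * pq) = sh sq * (sh pq * s + s * p) := by
    rw [← mul_assoc, ← h3, ← h2]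
    conv_lhs => rw [h3]
    rw [D_mul, D_sh, h2, sh_mul, h1]
    noncomm_ring
  obtain ⟨u, hu⟩ : ∃ u : PowerSeries (Sym K), u * sh sq = 1 := by
    refine ⟨_, PowerSeries.invOfUnit_mul (sh sq) 1 ?_⟩
    rw [← PowerSeries.coeff_zero_eq_constantCoeff_apply]
    simp [sh, sq, Sq]
  have h6 := congrArg (fun f => PowerSeries.coeff n (u * f)) h4
  simp only [← mul_assoc u, hu, one_mul] at h6
  simpa only [sh, s, p, pq, map_add, PowerSeries.coeff_mk, PowerSeries.coeff_mul,
    smul_mul_assoc] using h6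

end Sym

/-- The left combs: `leftComb n` is the left comb `L_{n+1}` with `n + 1` inner vertices, given by
`L₁ = Y` and `L_{n+1} = Lₙ ≻ Y`. -/
noncomputable def leftComb (K : Type) [Field K] : ℕ → Dend K
  | 0 => Dend.Y
  | n + 1 => Dend.succ (leftComb K n) Dend.Y

/-- The morphism of unital algebras `θ` from `Sym` to `Dend` with a unit added, with `Sₙ ↦ Lₙ`. -/
noncomputable def theta (K : Type) [Field K] : Sym K →ₐ[K] Unitization K (Dend K) :=
  FreeAlgebra.lift K fun n => (leftComb K n : Unitization K (Dend K))

end QOmega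

/-!
The dendriform axioms say that `≻` and `≺` make `Dend` a bimodule over the unital algebra generated
by `(Dend, *)`. In the trivial square-zero extension, the operator `R` carrying the bimodule to the
algebra is a Rota–Baxter operator, and the pre-Lie product of `Dend` becomes the commutator
`x ↶ a = [R a, x]`. Put `y = t Y` in the bimodule and `o = φ(Ω)`, `W = φ(Ω_q)` as power series in
`t`. The equation of `Ω` says that `e = exp (R o)` solves the linear equation `e = 1 + R (y e)`, and
the equation of `Ω_q`, conjugated by `e`, becomes

  `(R W)(t) e(t) = e(t) (R W)(qt) + (1 - q) t e'(t)`.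

On the other side, `s = ∑ θ(Sₙ) tⁿ` solves `s = 1 + R (s y)` because `L_{n+1} = L_n ≻ Y`, so by the
Rota–Baxter identity `s(-t)` is the inverse of `e(t)`. The series `z = (1 - q) ∑ θ(Ψₙ(A/(1-q))) tⁿ`
satisfies `s(t) z(t) = z(qt) s(t) + (1 - q) t s'(t)`. Replacing `t` by `-t` and dividing by `s(-t)`
shows that `z(-t)` and `-R W` solve the same equation, which determines every coefficient since
`q ^ n ≠ 1`.
-/

namespace QOmega

open PowerSeries
open Finset (range)
open Finset.HasAntidiagonal (antidiagonal mem_antidiagonal)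

/-! ### Power series of operators -/

section OperatorSeries

variable {K B : Type*} [CommRing K] [Ring B] [Algebra K B]

/-- The sum of the sequence `u` of power series. It is meaningful only when `u k` has order at
least `k`: then the terms with `k > m` do not contribute to the `m`-th coefficient. -/
noncomputable def seriesSum (u : ℕ → B⟦X⟧) : B⟦X⟧ :=
  PowerSeries.mk fun m => ∑ k ∈ range (m + 1), coeff m (u k)

theorem coeff_seriesSum_of_lt {u : ℕ → B⟦X⟧} (hu : ∀ k : ℕ, k ≤ (u k).order) {m N : ℕ}
    (hm : m < N) : coeff m (seriesSum u) = coeff m (∑ k ∈ range N, u k) := by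
  rw [seriesSum, coeff_mk, map_sum]
  refine Finset.sum_subset (Finset.range_mono hm) fun k _ hk => coeff_of_lt_order m ?_
  rw [Finset.mem_range, not_lt] at hk
  exact lt_of_lt_of_le (by exact_mod_cast hk) (hu k)

theorem seriesSum_sub (u v : ℕ → B⟦X⟧) :
    seriesSum (fun k => u k - v k) = seriesSum u - seriesSum v := by
  ext m
  simp only [seriesSum, coeff_mk, map_sub, Finset.sum_sub_distrib]

theorem seriesSum_eq_add {u : ℕ → B⟦X⟧} (hu : ∀ k : ℕ, k ≤ (u k).order) :
    seriesSum u = u 0 + seriesSum fun k => u (k + 1) := by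
  ext m
  rw [map_add, coeff_seriesSum_of_lt hu (show m < m + 1 + 1 by lia), Finset.sum_range_succ',
    add_comm, map_add, map_sum, seriesSum, coeff_mk]

theorem mul_seriesSum (x : B⟦X⟧) {u : ℕ → B⟦X⟧} (hu : ∀ k : ℕ, k ≤ (u k).order) :
    x * seriesSum u = seriesSum fun k => x * u k := by
  ext m
  calc coeff m (x * seriesSum u) = coeff m (x * ∑ k ∈ range (m + 1), u k) := by
        rw [coeff_mul, coeff_mul]
        exact Finset.sum_congr rfl fun p hp => congrArg _
          (coeff_seriesSum_of_lt hu (Finset.Nat.antidiagonal.snd_lt hp))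
    _ = coeff m (seriesSum fun k => x * u k) := by
        rw [seriesSum, coeff_mk, Finset.mul_sum, map_sum]

theorem seriesSum_mul {u : ℕ → B⟦X⟧} (hu : ∀ k : ℕ, k ≤ (u k).order) (x : B⟦X⟧) :
    seriesSum u * x = seriesSum fun k => u k * x := by
  ext m
  calc coeff m (seriesSum u * x) = coeff m ((∑ k ∈ range (m + 1), u k) * x) := by
        rw [coeff_mul, coeff_mul]
        exact Finset.sum_congr rfl fun p hp => congrArg (· * coeff p.2 x)
          (coeff_seriesSum_of_lt hu (Finset.Nat.antidiagonal.fst_lt hp))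
    _ = coeff m (seriesSum fun k => u k * x) := by
        rw [seriesSum, coeff_mk, Finset.sum_mul, map_sum]

/-- The operator `T` raises the order of power series by at least one, so that power series in `T`
make sense. -/
def RaisesOrder (T : Module.End K B⟦X⟧) : Prop :=
  ∀ x, x.order + 1 ≤ (T x).order

namespace RaisesOrder

variable {S T : Module.End K B⟦X⟧}

theorem sub (hS : RaisesOrder S) (hT : RaisesOrder T) : RaisesOrder (S - T) := fun x => by
  rw [LinearMap.sub_apply, sub_eq_add_neg]
  refine le_trans (le_min (hS x) ?_) (min_order_le_order_add _ _)
  rw [order_neg]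
  exact hT x

theorem order_add_le_order_pow_apply (hT : RaisesOrder T) (k : ℕ) (x : B⟦X⟧) :
    x.order + k ≤ ((T ^ k) x).order := by
  induction k with
  | zero => simp
  | succ k ih =>
    rw [pow_succ', Module.End.mul_apply, Nat.cast_succ, ← add_assoc]
    exact (add_le_add_left ih 1).trans (hT _)

theorem le_order_smul_pow_apply (hT : RaisesOrder T) (c : K) (k : ℕ) (x : B⟦X⟧) :
    k ≤ (c • (T ^ k) x).order := by
  rw [← map_smul]
  exact le_add_self.trans (hT.order_add_le_order_pow_apply k _)

theorem coeff_pow_apply_congr (hT : RaisesOrder T) (k : ℕ) {m : ℕ} {x y : B⟦X⟧}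
    (hxy : ∀ i ≤ m, coeff i x = coeff i y) : coeff m ((T ^ k) x) = coeff m ((T ^ k) y) := by
  have hsub : (m + 1 : ℕ) ≤ (x - y).order := le_order _ _ fun i hi => by
    rw [map_sub, hxy i (Nat.lt_succ_iff.1 (by exact_mod_cast hi)), sub_self]
  rw [← sub_eq_zero, ← map_sub, ← map_sub]
  refine coeff_of_lt_order m ?_
  calc (m : ℕ∞) < (m + 1 : ℕ) := by exact_mod_cast m.lt_succ_self
    _ ≤ (x - y).order := hsub
    _ ≤ (x - y).order + k := le_self_add
    _ ≤ _ := hT.order_add_le_order_pow_apply k _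

end RaisesOrder

/-- The value at `x` of the power series `f` in the operator `T`, which is meant to raise the
order. -/
noncomputable def opEval (f : K⟦X⟧) (T : Module.End K B⟦X⟧) (x : B⟦X⟧) : B⟦X⟧ :=
  seriesSum fun k => coeff k f • (T ^ k) x

theorem opEval_sub (f g : K⟦X⟧) (T : Module.End K B⟦X⟧) (x : B⟦X⟧) :
    opEval (f - g) T x = opEval f T x - opEval g T x := by
  simp only [opEval, ← seriesSum_sub, map_sub, sub_smul]

theorem opEval_one (T : Module.End K B⟦X⟧) (x : B⟦X⟧) : opEval 1 T x = x := by
  ext m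
  simp [opEval, seriesSum, Finset.sum_range_succ', coeff_one]

theorem sum_range_sum_antidiagonal {M : Type*} [AddCommMonoid M] (N : ℕ) (F : ℕ × ℕ → M)
    (hF : ∀ p, N ≤ p.1 + p.2 → F p = 0) :
    ∑ n ∈ range N, ∑ p ∈ antidiagonal n, F p = ∑ k ∈ range N, ∑ l ∈ range N, F (k, l) := by
  have hfiber : ∀ n ∈ range N,
      antidiagonal n = {p ∈ range N ×ˢ range N | p.1 + p.2 = n} := fun n hn => by
    ext p
    simp only [mem_antidiagonal, Finset.mem_filter, Finset.mem_product,
      Finset.mem_range] at hn ⊢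
    lia
  rw [← Finset.sum_product', Finset.sum_congr rfl fun n hn => by rw [hfiber n hn],
    Finset.sum_fiberwise_eq_sum_filter]
  refine Finset.sum_filter_of_ne fun p _ hp => Finset.mem_range.2 ?_
  by_contra h
  exact hp (hF p (not_lt.1 h))

theorem opEval_opEval {S T : Module.End K B⟦X⟧} (hS : RaisesOrder S) (hT : RaisesOrder T)
    (f g : K⟦X⟧) (x : B⟦X⟧) :
    opEval f S (opEval g T x) = seriesSum fun n => ∑ p ∈ antidiagonal n,
      (coeff p.1 f * coeff p.2 g) • (S ^ p.1) ((T ^ p.2) x) := by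
  ext m
  have hcoeff : ∀ i ≤ m, coeff i (opEval g T x) =
      coeff i (∑ l ∈ range (m + 1), coeff l g • (T ^ l) x) := fun i hi =>
    coeff_seriesSum_of_lt (fun l => hT.le_order_smul_pow_apply _ l x) (Nat.lt_succ_of_le hi)
  have hzero : ∀ p : ℕ × ℕ, m + 1 ≤ p.1 + p.2 →
      coeff m ((coeff p.1 f * coeff p.2 g) • (S ^ p.1) ((T ^ p.2) x)) = 0 := fun p hp => by
    refine coeff_of_lt_order m ?_
    rw [← map_smul, ← map_smul]
    calc (m : ℕ∞) < (p.2 + p.1 : ℕ) := by exact_mod_cast Nat.lt_of_succ_le (add_comm p.1 _ ▸ hp)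
      _ = p.2 + p.1 := Nat.cast_add _ _
      _ ≤ _ := add_le_add_left (le_add_self.trans (hT.order_add_le_order_pow_apply p.2 _)) _
      _ ≤ _ := hS.order_add_le_order_pow_apply p.1 _
  rw [opEval, seriesSum, seriesSum, coeff_mk, coeff_mk]
  simp only [map_sum (coeff m)]
  rw [sum_range_sum_antidiagonal _ _ hzero]
  refine Finset.sum_congr rfl fun k _ => ?_
  rw [coeff_smul, hS.coeff_pow_apply_congr k hcoeff, ← coeff_smul, map_sum, Finset.smul_sum,
    map_sum]
  simp only [map_smul, smul_smul]

theorem opEval_mul {T : Module.End K B⟦X⟧} (hT : RaisesOrder T) (f g : K⟦X⟧) (x : B⟦X⟧) :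
    opEval (f * g) T x = opEval f T (opEval g T x) := by
  rw [opEval_opEval hT hT, opEval]
  congr! 2 with n
  rw [coeff_mul, Finset.sum_smul]
  refine Finset.sum_congr rfl fun p hp => ?_
  rw [← Module.End.mul_apply, ← pow_add, mem_antidiagonal.1 hp]

end OperatorSeries

section Multiplication

variable {K B : Type*} [CommRing K] [Ring B] [Algebra K B]

variable (K) in
/-- The inner derivation `x ↦ a * x - x * a`. -/
noncomputable def ad (a : B⟦X⟧) : Module.End K B⟦X⟧ :=
  LinearMap.mulLeft K a - LinearMap.mulRight K a

theorem ad_apply (a x : B⟦X⟧) : ad K a x = a * x - x * a := rfl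

theorem commute_ad_mulRight (a : B⟦X⟧) : Commute (ad K a) (LinearMap.mulRight K a) :=
  (LinearMap.commute_mulLeft_right a a).sub_left (Commute.refl _)

theorem ad_add_mulRight (a : B⟦X⟧) : ad K a + LinearMap.mulRight K a = LinearMap.mulLeft K a :=
  sub_add_cancel _ _

variable {a : B⟦X⟧}

theorem raisesOrder_mulLeft (ha : constantCoeff a = 0) :
    RaisesOrder (LinearMap.mulLeft K a) := fun x => by
  rw [add_comm]
  exact (add_le_add_left (one_le_order_iff_constCoeff_eq_zero.2 ha) _).trans (le_order_mul _ _)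

theorem raisesOrder_mulRight (ha : constantCoeff a = 0) :
    RaisesOrder (LinearMap.mulRight K a) := fun _ =>
  (add_le_add_right (one_le_order_iff_constCoeff_eq_zero.2 ha) _).trans (le_order_mul _ _)

theorem raisesOrder_ad (ha : constantCoeff a = 0) : RaisesOrder (ad K a) :=
  (raisesOrder_mulLeft ha).sub (raisesOrder_mulRight ha)

theorem le_order_smul_pow (ha : constantCoeff a = 0) (c : K) (n : ℕ) :
    n ≤ (c • a ^ n).order :=
  (le_order_pow_of_constantCoeff_eq_zero n ha).trans <| le_order _ _ fun i hi => by
    rw [coeff_smul, coeff_of_lt_order i hi, smul_zero]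

end Multiplication

/-! ### Exponentials of commuting operators -/

section Exponential

variable {K B : Type*} [CommRing K] [Algebra ℚ K] [Ring B] [Algebra K B]

variable (K) in
/-- The power series `(exp z - 1) / z`, the inverse of `bernoulliPowerSeries`. -/
noncomputable def expSubOneDiv : K⟦X⟧ :=
  PowerSeries.mk fun n => coeff (n + 1) (PowerSeries.exp K)

theorem expSubOneDiv_mul_bernoulliPowerSeries :
    expSubOneDiv K * bernoulliPowerSeries K = 1 := by
  have hmul : expSubOneDiv K * X = PowerSeries.exp K - 1 := by
    ext (_ | n)
    · simp
    · simp [expSubOneDiv, coeff_succ_mul_X, coeff_one]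
  refine X_mul_cancel ?_
  rw [mul_one, ← mul_assoc, mul_comm X, hmul, mul_comm, bernoulliPowerSeries_mul_exp_sub_one]

variable (K) in
theorem coeff_exp_mul_coeff_exp (i j : ℕ) :
    coeff i (PowerSeries.exp K) * coeff j (PowerSeries.exp K) =
      (i + j).choose i * coeff (i + j) (PowerSeries.exp K) := by
  have hrat : (1 / i.factorial * (1 / j.factorial) : ℚ) =
      (i + j).choose i * (1 / (i + j).factorial) := by
    rw [← Nat.add_choose_mul_factorial_mul_factorial i j, Nat.choose_symm_add]
    have := Nat.choose_pos (Nat.le_add_left j i)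
    push_cast
    field_simp
  rw [coeff_exp, coeff_exp, coeff_exp, ← map_mul, hrat, map_mul, map_natCast]

theorem opEval_exp_add {S T : Module.End K B⟦X⟧} (hS : RaisesOrder S) (hT : RaisesOrder T)
    (hST : Commute S T) (x : B⟦X⟧) :
    opEval (PowerSeries.exp K) (S + T) x =
      opEval (PowerSeries.exp K) S (opEval (PowerSeries.exp K) T x) := by
  rw [opEval_opEval hS hT, opEval]
  congr! 2 with n
  rw [hST.add_pow', LinearMap.sum_apply, Finset.smul_sum]
  refine Finset.sum_congr rfl fun p hp => ?_
  rw [coeff_exp_mul_coeff_exp, mem_antidiagonal.1 hp, mul_comm, mul_smul, Nat.cast_smul_eq_nsmul,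
    LinearMap.smul_apply, Module.End.mul_apply]

theorem sum_add_pow_mul_pow_eq {A : Type*} [Ring A] {s t : A} (hst : Commute s t) (n : ℕ) :
    ∑ i ∈ range (n + 1), (s + t) ^ i * t ^ (n - i) =
      ∑ p ∈ antidiagonal n, (n + 1).choose p.1 • (t ^ p.1 * s ^ p.2) := by
  induction n with
  | zero => simp
  | succ n ih =>
    have hgeom := (hst.add_left (Commute.refl t)).geom_sum₂_succ_eq (n := n + 1)
    rw [Nat.add_sub_cancel] at hgeom
    rw [hgeom, ih, add_comm s t, hst.symm.add_pow', Finset.Nat.sum_antidiagonal_succ,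
      Finset.Nat.sum_antidiagonal_succ, Finset.mul_sum, add_assoc, ← Finset.sum_add_distrib]
    congr 1
    refine Finset.sum_congr rfl fun p _ => ?_
    rw [Nat.choose_succ_succ' (n + 1), add_smul, pow_succ', mul_smul_comm, mul_assoc, add_comm]

theorem opEval_exp_opEval_expSubOneDiv {S T : Module.End K B⟦X⟧} (hS : RaisesOrder S)
    (hT : RaisesOrder T) (hST : Commute S T) (x : B⟦X⟧) :
    opEval (PowerSeries.exp K) T (opEval (expSubOneDiv K) S x) =
      seriesSum fun n => coeff (n + 1) (PowerSeries.exp K) •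
        (∑ i ∈ range (n + 1), (S + T) ^ i * T ^ (n - i)) x := by
  rw [opEval_opEval hT hS]
  congr! 2 with n
  rw [sum_add_pow_mul_pow_eq hST, LinearMap.sum_apply, Finset.smul_sum]
  refine Finset.sum_congr rfl fun p hp => ?_
  rw [expSubOneDiv, coeff_mk, coeff_exp_mul_coeff_exp, ← add_assoc, mem_antidiagonal.1 hp, mul_comm,
    mul_smul, Nat.cast_smul_eq_nsmul, LinearMap.smul_apply, Module.End.mul_apply]

variable {a : B⟦X⟧}

variable (K) in
/-- The exponential of a power series `a` without constant term. -/
noncomputable def expSeries (a : B⟦X⟧) : B⟦X⟧ :=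
  seriesSum fun n => coeff n (PowerSeries.exp K) • a ^ n

theorem opEval_exp_mulLeft (ha : constantCoeff a = 0) (x : B⟦X⟧) :
    opEval (PowerSeries.exp K) (LinearMap.mulLeft K a) x = expSeries K a * x := by
  rw [expSeries, seriesSum_mul fun n => le_order_smul_pow ha _ n, opEval]
  simp only [LinearMap.pow_mulLeft, LinearMap.mulLeft_apply, smul_mul_assoc]

theorem opEval_exp_mulRight (ha : constantCoeff a = 0) (x : B⟦X⟧) :
    opEval (PowerSeries.exp K) (LinearMap.mulRight K a) x = x * expSeries K a := by
  rw [expSeries, mul_seriesSum _ fun n => le_order_smul_pow ha _ n, opEval]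
  simp only [LinearMap.pow_mulRight, LinearMap.mulRight_apply, mul_smul_comm]

theorem opEval_exp_ad_mul_expSeries (ha : constantCoeff a = 0) (x : B⟦X⟧) :
    opEval (PowerSeries.exp K) (ad K a) x * expSeries K a = expSeries K a * x := by
  rw [← opEval_exp_mulRight ha, ← opEval_exp_mulLeft ha, ← ad_add_mulRight, add_comm,
    opEval_exp_add (raisesOrder_mulRight ha) (raisesOrder_ad ha) (commute_ad_mulRight a).symm]

theorem opEval_expSubOneDiv_ad_mul_expSeries (ha : constantCoeff a = 0) (x : B⟦X⟧) :
    opEval (expSubOneDiv K) (ad K a) x * expSeries K a =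
      seriesSum fun n => coeff (n + 1) (PowerSeries.exp K) •
        ∑ i ∈ range (n + 1), a ^ i * x * a ^ (n - i) := by
  rw [← opEval_exp_mulRight ha, opEval_exp_opEval_expSubOneDiv (raisesOrder_ad ha)
    (raisesOrder_mulRight ha) (commute_ad_mulRight a), ad_add_mulRight]
  simp only [LinearMap.sum_apply, Module.End.mul_apply, LinearMap.pow_mulLeft,
    LinearMap.pow_mulRight, LinearMap.mulLeft_apply, LinearMap.mulRight_apply, mul_assoc]

end Exponential

/-! ### Rota–Baxter operators -/

section RotaBaxter

variable {K A : Type*} [CommRing K] [Ring A] [Algebra K A]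

/-- A Rota–Baxter operator of weight zero: `R` satisfies the identity of integration by parts. -/
def IsRotaBaxter (R : A →ₗ[K] A) : Prop :=
  ∀ x y, R x * R y = R (x * R y + R x * y)

namespace IsRotaBaxter

variable {R : A →ₗ[K] A}

theorem map_sum_pow_mul_mul_pow (hR : IsRotaBaxter R) (x : A) (n : ℕ) :
    R (∑ i ∈ range (n + 1), R x ^ i * x * R x ^ (n - i)) = R x ^ (n + 1) := by
  induction n with
  | zero => simp
  | succ n ih =>
    have hsum : ∑ i ∈ range (n + 1), R x ^ i * x * R x ^ (n + 1 - i) =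
        (∑ i ∈ range (n + 1), R x ^ i * x * R x ^ (n - i)) * R x := by
      rw [Finset.sum_mul]
      refine Finset.sum_congr rfl fun i hi => ?_
      rw [Nat.sub_add_comm (Finset.mem_range_succ_iff.1 hi), pow_succ, ← mul_assoc]
    rw [Finset.sum_range_succ, hsum, Nat.sub_self, pow_zero, mul_one, pow_succ _ (n + 1), ← ih, hR,
      ih]

theorem mul_eq_one (hR : IsRotaBaxter R) {y e f : A} (he : e = 1 + R (y * e))
    (hf : f = 1 - R (f * y)) : f * e = 1 := by
  have he' : R (y * e) = e - 1 := (sub_eq_of_eq_add' he).symm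
  have hf' : R (f * y) = 1 - f := by rw [eq_sub_iff_add_eq, add_comm, ← eq_sub_iff_add_eq, ← hf]
  have hprod : (1 - f) * (e - 1) = e - 1 - (1 - f) :=
    calc (1 - f) * (e - 1) = R (f * y * (e - 1) + (1 - f) * (y * e)) := by
          rw [← he', ← hf', hR]
      _ = R (y * e) - R (f * y) := by rw [← map_sub]; congr 1; noncomm_ring
      _ = e - 1 - (1 - f) := by rw [he', hf']
  linear_combination (norm := noncomm_ring) -hprod

/-- The defect in the commutation of `R w` with `e`, twisted by `w ↦ w'`, solves the integral
equation that the Euler derivative of the solution `e` of `e = 1 + R (y * e)` solves. -/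
theorem mul_sub_mul_eq (hR : IsRotaBaxter R) {y e w w' : A} {q : K} (he : e = 1 + R (y * e))
    (hw : e * w' = (w + (R w * y - y * R w) + (q - 1) • y) * e) :
    R w * e - e * R w' = R (y * (R w * e - e * R w')) + (1 - q) • (e - 1) := by
  have he' : R (y * e) = e - 1 := (sub_eq_of_eq_add' he).symm
  have hleft : R w * e = R (w * e + R w * (y * e)) :=
    calc R w * e = R w + R w * R (y * e) := by rw [he']; noncomm_ring
      _ = R (w * e + R w * (y * e)) := by
        rw [hR, he', ← map_add]; congr 1; noncomm_ring
  have hright : e * R w' = R (y * e * R w' + e * w') :=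
    calc e * R w' = R w' + R (y * e) * R w' := by rw [he']; noncomm_ring
      _ = R (y * e * R w' + e * w') := by
        rw [hR, he', ← map_add]; congr 1; noncomm_ring
  rw [← he', ← map_smul, ← map_add]
  nth_rewrite 1 [hleft, hright]
  rw [← map_sub]
  congr 1
  rw [hw]
  simp only [add_mul, sub_mul, smul_mul_assoc, mul_sub, sub_smul, one_smul, mul_assoc]
  abel

end IsRotaBaxter

end RotaBaxter

/-! ### Coefficientwise operators on power series -/

section Coefficientwise

variable {K A : Type*} [CommRing K] [Ring A] [Algebra K A]

theorem eq_zero_of_coeff_eq_zero_of_le_order {x : A⟦X⟧}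
    (hx : ∀ n : ℕ, n ≤ x.order → coeff n x = 0) : x = 0 := by
  by_contra hne
  exact coeff_order hne (hx _ (coe_toNat_order hne).le)

/-- The operator `∑ aₙ tⁿ ↦ ∑ R aₙ tⁿ`. -/
noncomputable def mapCoeff (R : A →ₗ[K] A) : A⟦X⟧ →ₗ[K] A⟦X⟧ where
  toFun x := PowerSeries.mk fun n => R (coeff n x)
  map_add' x y := by ext n; simp
  map_smul' c x := by ext n; simp

/-- The substitution `∑ aₙ tⁿ ↦ ∑ cⁿ aₙ tⁿ`; unlike `PowerSeries.rescale` it does not require the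
coefficients to commute. -/
noncomputable def dilate (c : K) : A⟦X⟧ →ₐ[K] A⟦X⟧ :=
  AlgHom.ofLinearMap
    { toFun := fun x => PowerSeries.mk fun n => c ^ n • coeff n x
      map_add' := fun x y => by ext n; simp
      map_smul' := fun d x => by ext n; simp [smul_comm d] }
    (by ext (_ | n) <;> simp [coeff_one])
    (fun x y => by
      ext n
      simp only [LinearMap.coe_mk, AddHom.coe_mk, coeff_mk, coeff_mul, Finset.smul_sum]
      refine Finset.sum_congr rfl fun p hp => ?_
      rw [smul_mul_smul_comm, ← pow_add, mem_antidiagonal.1 hp])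

/-- The derivation `t d/dt`, that is, `∑ aₙ tⁿ ↦ ∑ n aₙ tⁿ`. -/
noncomputable def euler : A⟦X⟧ →+ A⟦X⟧ where
  toFun x := PowerSeries.mk fun n => n • coeff n x
  map_zero' := by ext n; simp
  map_add' x y := by ext n; simp

theorem coeff_mapCoeff (R : A →ₗ[K] A) (x : A⟦X⟧) (n : ℕ) :
    coeff n (mapCoeff R x) = R (coeff n x) := coeff_mk n fun n => R (coeff n x)

theorem coeff_dilate (c : K) (x : A⟦X⟧) (n : ℕ) : coeff n (dilate c x) = c ^ n • coeff n x :=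
  coeff_mk n fun n => c ^ n • coeff n x

theorem coeff_euler (x : A⟦X⟧) (n : ℕ) : coeff n (euler x) = n • coeff n x :=
  coeff_mk n fun n => n • coeff n x

theorem mapCoeff_seriesSum (R : A →ₗ[K] A) (u : ℕ → A⟦X⟧) :
    mapCoeff R (seriesSum u) = seriesSum fun k => mapCoeff R (u k) := by
  ext m
  simp only [coeff_mapCoeff, seriesSum, coeff_mk, map_sum]

theorem dilate_dilate (c d : K) (x : A⟦X⟧) : dilate c (dilate d x) = dilate (c * d) x := by
  ext n
  simp only [coeff_dilate, smul_smul, mul_pow]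

theorem dilate_mapCoeff (c : K) (R : A →ₗ[K] A) (x : A⟦X⟧) :
    dilate c (mapCoeff R x) = mapCoeff R (dilate c x) := by
  ext n
  simp only [coeff_dilate, coeff_mapCoeff, map_smul]

theorem dilate_monomial_one (c : K) (b : A) : dilate c (monomial 1 b) = c • monomial 1 b := by
  ext n
  rcases eq_or_ne n 1 with rfl | hn
  · simp [coeff_dilate]
  · simp [coeff_dilate, coeff_monomial, hn]

theorem euler_one : euler (1 : A⟦X⟧) = 0 := by
  ext (_ | n) <;> simp [coeff_euler, coeff_one]

theorem euler_mul (x y : A⟦X⟧) : euler (x * y) = euler x * y + x * euler y := by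
  ext n
  simp only [coeff_euler, map_add, coeff_mul, Finset.smul_sum, ← Finset.sum_add_distrib]
  refine Finset.sum_congr rfl fun p hp => ?_
  rw [← mem_antidiagonal.1 hp, add_smul, smul_mul_assoc, mul_smul_comm]

theorem euler_dilate (c : K) (x : A⟦X⟧) : euler (dilate c x) = dilate c (euler x) := by
  ext n
  simp only [coeff_euler, coeff_dilate, smul_comm n]

theorem euler_mapCoeff (R : A →ₗ[K] A) (x : A⟦X⟧) :
    euler (mapCoeff R x) = mapCoeff R (euler x) := by
  ext n
  simp only [coeff_euler, coeff_mapCoeff, map_nsmul]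

theorem constantCoeff_mapCoeff (R : A →ₗ[K] A) (x : A⟦X⟧) :
    constantCoeff (mapCoeff R x) = R (constantCoeff x) := by
  rw [← coeff_zero_eq_constantCoeff_apply, coeff_mapCoeff, coeff_zero_eq_constantCoeff_apply]

theorem constantCoeff_dilate (c : K) (x : A⟦X⟧) :
    constantCoeff (dilate c x) = constantCoeff x := by
  rw [← coeff_zero_eq_constantCoeff_apply, coeff_dilate, coeff_zero_eq_constantCoeff_apply,
    pow_zero, one_smul]

theorem constantCoeff_monomial_one (b : A) : constantCoeff (monomial 1 b) = 0 := by
  rw [← coeff_zero_eq_constantCoeff_apply, coeff_monomial, if_neg zero_ne_one]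

theorem coeff_succ_mul_monomial_one (x : A⟦X⟧) (b : A) (n : ℕ) :
    coeff (n + 1) (x * monomial 1 b) = coeff n x * b := by
  simp only [coeff, monomial, Finsupp.single_add]
  exact MvPowerSeries.coeff_add_mul_monomial (Finsupp.single () n) _ x b

theorem euler_monomial_one (b : A) : euler (monomial 1 b) = monomial 1 b := by
  ext n
  rcases eq_or_ne n 1 with rfl | hn
  · simp [coeff_euler]
  · simp [coeff_euler, coeff_monomial, hn]

theorem eq_zero_of_eq_mapCoeff_mul {R : A →ₗ[K] A} {y x : A⟦X⟧} (hy : constantCoeff y = 0)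
    (hx : x = mapCoeff R (y * x)) : x = 0 := by
  refine eq_zero_of_coeff_eq_zero_of_le_order fun n hn => ?_
  have hyx : (n : ℕ∞) < (y * x).order :=
    calc (n : ℕ∞) < 1 + n := by rw [add_comm]; exact_mod_cast n.lt_succ_self
      _ ≤ y.order + x.order := add_le_add (one_le_order_iff_constCoeff_eq_zero.2 hy) hn
      _ ≤ (y * x).order := le_order_mul _ _
  rw [hx, coeff_mapCoeff, coeff_of_lt_order n hyx, map_zero]

protected theorem IsRotaBaxter.mapCoeff {R : A →ₗ[K] A} (hR : IsRotaBaxter R) :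
    IsRotaBaxter (mapCoeff R) := by
  intro x y
  ext n
  simp only [coeff_mapCoeff, coeff_mul, map_add, map_sum, ← Finset.sum_add_distrib]
  exact Finset.sum_congr rfl fun p _ => by rw [hR, map_add]

end Coefficientwise

/-! ### The `q`-logarithmic derivative -/

section QLogDeriv

variable {K A B : Type*} [CommRing K] [Ring A] [Algebra K A] [Ring B] [Algebra K B]

/-- The series `z` is the `q`-analogue of the logarithmic derivative of `s`: if the coefficients
commute, the condition reads `(z(t) - z(qt)) / (1 - q) = t s'(t) / s(t)`. -/
def IsQLogDeriv (q : K) (s z : A⟦X⟧) : Prop :=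
  s * z = dilate q z * s + (1 - q) • euler s

protected theorem IsQLogDeriv.dilate {q : K} {s z : A⟦X⟧} (h : IsQLogDeriv q s z) (c : K) :
    IsQLogDeriv q (dilate c s) (dilate c z) := by
  rw [IsQLogDeriv, dilate_dilate, mul_comm q, ← dilate_dilate, euler_dilate, ← map_mul, ← map_mul,
    ← map_smul, ← map_add]
  exact congrArg (dilate c) h

protected theorem IsQLogDeriv.map {q : K} {s z : A⟦X⟧} (h : IsQLogDeriv q s z) (f : A →ₐ[K] B) :
    IsQLogDeriv q (mapAlgHom f s) (mapAlgHom f z) := by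
  have hdilate : dilate q (mapAlgHom f z) = mapAlgHom f (dilate q z) := by
    ext n
    simp [coeff_dilate, mapAlgHom_apply]
  have heuler : euler (mapAlgHom f s) = mapAlgHom f (euler s) := by
    ext n
    simp [coeff_euler, mapAlgHom_apply]
  rw [IsQLogDeriv, hdilate, heuler, ← map_mul, ← map_mul, ← map_smul, ← map_add]
  exact congrArg (mapAlgHom f) h

theorem coeff_mul_mul_of_le_order {n : ℕ} {f x e : A⟦X⟧} (hf : constantCoeff f = 1)
    (he : constantCoeff e = 1) (hx : n ≤ x.order) : coeff n (f * x * e) = coeff n x := by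
  have hn : (n : ℕ∞) < 1 + n := by rw [add_comm]; exact_mod_cast n.lt_succ_self
  have hleft : (n : ℕ∞) < ((f - 1) * x * e).order :=
    calc (n : ℕ∞) < 1 + n := hn
      _ ≤ (f - 1).order + x.order :=
        add_le_add (one_le_order_iff_constCoeff_eq_zero.2 (by simp [hf])) hx
      _ ≤ ((f - 1) * x).order := le_order_mul _ _
      _ ≤ ((f - 1) * x).order + e.order := le_self_add
      _ ≤ ((f - 1) * x * e).order := le_order_mul _ _
  have hright : (n : ℕ∞) < (x * (e - 1)).order :=
    calc (n : ℕ∞) < n + 1 := add_comm 1 (n : ℕ∞) ▸ hn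
      _ ≤ x.order + (e - 1).order :=
        add_le_add hx (one_le_order_iff_constCoeff_eq_zero.2 (by simp [he]))
      _ ≤ (x * (e - 1)).order := le_order_mul _ _
  rw [show f * x * e = (f - 1) * x * e + (x * (e - 1) + x) by noncomm_ring, map_add, map_add,
    coeff_of_lt_order n hleft, coeff_of_lt_order n hright, zero_add, zero_add]

end QLogDeriv

section

variable {K A : Type*} [Field K] [Ring A] [Algebra K A] {q : K}

theorem eq_zero_of_mul_mul_eq_dilate (hq : ∀ n, 0 < n → q ^ n ≠ 1) {f x e : A⟦X⟧}
    (hf : constantCoeff f = 1) (he : constantCoeff e = 1) (hx : constantCoeff x = 0)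
    (h : f * x * e = dilate q x) : x = 0 := by
  refine eq_zero_of_coeff_eq_zero_of_le_order fun n hn => ?_
  rcases n.eq_zero_or_pos with rfl | hpos
  · rw [coeff_zero_eq_constantCoeff_apply, hx]
  have hfix : (1 - q ^ n) • coeff n x = 0 := by
    rw [sub_smul, one_smul, ← coeff_dilate, ← h, coeff_mul_mul_of_le_order hf he hn, sub_self]
  exact (smul_eq_zero.1 hfix).resolve_left (sub_ne_zero.2 (hq n hpos).symm)

theorem IsQLogDeriv.eq_neg_of_mul_eq_one (hq : ∀ n, 0 < n → q ^ n ≠ 1) {f z e w : A⟦X⟧}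
    (hf : constantCoeff f = 1) (he : constantCoeff e = 1) (hz : constantCoeff z = 0)
    (hw : constantCoeff w = 0) (hfz : IsQLogDeriv q f z) (hfe : f * e = 1)
    (hwe : w * e = e * dilate q w + (1 - q) • euler e) : z = -w := by
  have heuler : euler f * e + f * euler e = 0 := by rw [← euler_mul, hfe, euler_one]
  have hconj : f * (z + w) * e = dilate q (z + w) :=
    calc f * (z + w) * e = f * z * e + f * (w * e) := by noncomm_ring
      _ = dilate q z * (f * e) + f * e * dilate q w +
          (1 - q) • (euler f * e + f * euler e) := by
        rw [hfz, hwe]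
        simp only [add_mul, mul_add, smul_mul_assoc, mul_smul_comm, smul_add, mul_assoc]
        abel
      _ = dilate q (z + w) := by rw [hfe, heuler, mul_one, one_mul, smul_zero, add_zero, map_add]
  refine eq_neg_of_add_eq_zero_left (eq_zero_of_mul_mul_eq_dilate hq hf he ?_ hconj)
  rw [map_add, hz, hw, add_zero]

end

/-! ### The equations of `Ω` and `Ω_q` in a Rota–Baxter algebra -/

section Magnus

variable {K A : Type*} [CommRing K] [Ring A] [Algebra K A] {R : A →ₗ[K] A}

/-- The pre-Lie Magnus expansion: `hy` is the equation of `Ω`, and the exponential turns it into a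
linear integral equation. -/
theorem IsRotaBaxter.expSeries_eq [Algebra ℚ K] (hR : IsRotaBaxter R) {y o : A⟦X⟧}
    (ho : constantCoeff o = 0)
    (hy : opEval (bernoulliPowerSeries K) (ad K (mapCoeff R o)) y = o) :
    expSeries K (mapCoeff R o) =
      1 + mapCoeff R (y * expSeries K (mapCoeff R o)) := by
  set w := mapCoeff R o with hw
  have hw0 : constantCoeff w = 0 := by rw [constantCoeff_mapCoeff, ho, map_zero]
  have hyo : y = opEval (expSubOneDiv K) (ad K w) o := by
    conv_rhs => rw [← hy, ← opEval_mul (raisesOrder_ad hw0), expSubOneDiv_mul_bernoulliPowerSeries,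
      opEval_one]
  rw [hyo, opEval_expSubOneDiv_ad_mul_expSeries hw0, mapCoeff_seriesSum]
  simp only [map_smul, hw, hR.mapCoeff.map_sum_pow_mul_mul_pow]
  rw [← hw, expSeries, seriesSum_eq_add fun n => le_order_smul_pow hw0 _ n]
  simp

theorem IsRotaBaxter.mapCoeff_mul_eq (hR : IsRotaBaxter R) {q : K} {b : A} {e W : A⟦X⟧}
    (he : e = 1 + mapCoeff R (monomial 1 b * e))
    (hW : e * dilate q W = (W + ad K (mapCoeff R W) (monomial 1 b) +
      (q - 1) • monomial 1 b) * e) :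
    mapCoeff R W * e = e * dilate q (mapCoeff R W) + (1 - q) • euler e := by
  have heuler : euler e = mapCoeff R (monomial 1 b * euler e) + (e - 1) := by
    conv_lhs => rw [he, map_add, euler_one, zero_add, euler_mapCoeff, euler_mul,
      euler_monomial_one, map_add, ← sub_eq_of_eq_add' he, add_comm]
  have hdefect := hR.mapCoeff.mul_sub_mul_eq he hW
  rw [← dilate_mapCoeff] at hdefect
  set U := mapCoeff R W * e - e * dilate q (mapCoeff R W)
  have hdiff : U - (1 - q) • euler e =
      mapCoeff R (monomial 1 b * (U - (1 - q) • euler e)) := by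
    conv_lhs => rw [hdefect, heuler]
    simp only [mul_sub, mul_smul_comm, map_sub, map_smul]
    module
  rw [← sub_eq_iff_eq_add', ← sub_eq_zero]
  exact eq_zero_of_eq_mapCoeff_mul (constantCoeff_monomial_one b) hdiff

theorem dilate_neg_one_eq_one_sub_mapCoeff {b : A} {s : A⟦X⟧}
    (hs : s = 1 + mapCoeff R (s * monomial 1 b)) :
    dilate (-1 : K) s = 1 - mapCoeff R (dilate (-1 : K) s * monomial 1 b) := by
  conv_lhs => rw [hs, map_add, map_one, dilate_mapCoeff, map_mul, dilate_monomial_one, neg_one_smul,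
    mul_neg, map_neg, ← sub_eq_add_neg]

end Magnus

section

variable {K A : Type*} [Field K] [Algebra ℚ K] [Ring A] [Algebra K A] {R : A →ₗ[K] A} {q : K}

theorem IsRotaBaxter.dilate_neg_one_eq_neg_mapCoeff (hR : IsRotaBaxter R)
    (hq : ∀ n, 0 < n → q ^ n ≠ 1) {b : A} {o W s z : A⟦X⟧} (ho : constantCoeff o = 0)
    (hW0 : constantCoeff W = 0) (hz0 : constantCoeff z = 0)
    (hoeq : opEval (bernoulliPowerSeries K) (ad K (mapCoeff R o)) (monomial 1 b) = o)
    (hW : opEval (PowerSeries.exp K - 1) (ad K (mapCoeff R o)) (dilate q W) +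
      dilate q W - W = ad K (mapCoeff R W) (monomial 1 b) + (q - 1) • monomial 1 b)
    (hs : s = 1 + mapCoeff R (s * monomial 1 b)) (hz : IsQLogDeriv q s z) :
    dilate (-1 : K) z = -mapCoeff R W := by
  have hw0 : constantCoeff (mapCoeff R o) = 0 := by
    rw [constantCoeff_mapCoeff, ho, map_zero]
  have he := hR.expSeries_eq ho hoeq
  have hf := dilate_neg_one_eq_one_sub_mapCoeff hs
  set e := expSeries K (mapCoeff R o)
  have heW : e * dilate q W = (W + ad K (mapCoeff R W) (monomial 1 b) +
      (q - 1) • monomial 1 b) * e := by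
    rw [add_assoc, ← hW, ← opEval_exp_ad_mul_expSeries hw0, opEval_sub, opEval_one]
    congr 1
    abel
  have he0 : constantCoeff e = 1 := by
    rw [he]
    simp [constantCoeff_mapCoeff, constantCoeff_monomial_one]
  have hf0 : constantCoeff (dilate (-1 : K) s) = 1 := by
    rw [hf]
    simp [constantCoeff_mapCoeff, constantCoeff_monomial_one]
  exact (hz.dilate (-1)).eq_neg_of_mul_eq_one hq hf0 he0 (by rw [constantCoeff_dilate, hz0])
    (by rw [constantCoeff_mapCoeff, hW0, map_zero]) (hR.mapCoeff.mul_eq_one he hf)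
    (hR.mapCoeff_mul_eq he heW)

end

/-! ### The dendriform algebra as a bimodule over its unital associative algebra -/

section Bimodule

variable {K : Type} [Field K]

variable (K) in
/-- The operation `≻` as a left action of the associative algebra `Dend` on itself. -/
noncomputable def Dend.succHom : Dend K →ₙₐ[K] Module.End K (Dend K) where
  __ := Dend.succ
  map_zero' := map_zero Dend.succ
  map_mul' x y := by
    ext z
    exact (congrArg (Dend.succ · z) (Dend.mul_def x y)).trans (by simp [Dend.succ_succ])

variable (K) in
/-- The operation `≺` as a right action of the associative algebra `Dend` on itself. -/
noncomputable def Dend.precHom : Dend K →ₙₐ[K] (Module.End K (Dend K))ᵐᵒᵖ where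
  toFun x := MulOpposite.op (Dend.prec.flip x)
  map_zero' := by simp
  map_add' x y := by simp
  map_smul' c x := by simp
  map_mul' x y := by
    rw [← MulOpposite.op_mul]
    congr 1
    ext z
    simp [Dend.mul_def, ← Dend.prec_prec, add_comm]

noncomputable instance Dend.leftModule : Module (Unitization K (Dend K)) (Dend K) :=
  Module.compHom _ (Unitization.lift (Dend.succHom K)).toRingHom

noncomputable instance Dend.rightModule : Module (Unitization K (Dend K))ᵐᵒᵖ (Dend K) :=
  Module.compHom _ (AlgHom.opComm (Unitization.lift (Dend.precHom K))).toRingHom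

theorem Dend.smul_def (a : Unitization K (Dend K)) (m : Dend K) :
    a • m = a.fst • m + Dend.succ a.snd m := by
  change Unitization.lift (Dend.succHom K) a m = _
  rfl

theorem Dend.op_smul_def (a : Unitization K (Dend K)) (m : Dend K) :
    MulOpposite.op a • m = a.fst • m + Dend.prec m a.snd := by
  change (Unitization.lift (Dend.precHom K) a).unop m = _
  rfl

instance Dend.smulCommClass :
    SMulCommClass (Unitization K (Dend K)) (Unitization K (Dend K))ᵐᵒᵖ (Dend K) where
  smul_comm a b m := by
    induction b using MulOpposite.rec' with
    | _ b =>
    simp only [Dend.smul_def, Dend.op_smul_def, map_add, map_smul, LinearMap.add_apply,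
      LinearMap.smul_apply, Dend.succ_prec]
    module

instance Dend.isScalarTower : IsScalarTower K (Unitization K (Dend K)) (Dend K) where
  smul_assoc c a m := by
    simp only [Dend.smul_def, Unitization.fst_smul, Unitization.snd_smul, map_smul,
      LinearMap.smul_apply, smul_eq_mul]
    module

instance Dend.isScalarTower_op : IsScalarTower K (Unitization K (Dend K))ᵐᵒᵖ (Dend K) where
  smul_assoc c a m := by
    induction a using MulOpposite.rec' with
    | _ a =>
    rw [← MulOpposite.op_smul]
    simp only [Dend.op_smul_def, Unitization.fst_smul, Unitization.snd_smul, map_smul,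
      smul_eq_mul]
    module

variable (K) in
/-- The trivial square-zero extension of the unital algebra generated by `Dend` by the bimodule
`Dend`. -/
abbrev DendExt : Type := TrivSqZeroExt (Unitization K (Dend K)) (Dend K)

variable (K) in
/-- The operator on `DendExt` that maps the bimodule `Dend` identically onto the algebra `Dend` and
kills the algebra. -/
noncomputable def DendExt.R : DendExt K →ₗ[K] DendExt K where
  toFun x := TrivSqZeroExt.inl (x.snd : Unitization K (Dend K))
  map_add' x y := by simp
  map_smul' c x := by ext <;> simp

theorem DendExt.R_inr (m : Dend K) :
    DendExt.R K (TrivSqZeroExt.inr m) = TrivSqZeroExt.inl (m : Unitization K (Dend K)) := rfl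

theorem DendExt.isRotaBaxter_R : IsRotaBaxter (DendExt.R K) := by
  intro x y
  change TrivSqZeroExt.inl (x.snd : Unitization K (Dend K)) *
    TrivSqZeroExt.inl (y.snd : Unitization K (Dend K)) = TrivSqZeroExt.inl _
  rw [← TrivSqZeroExt.inl_mul, ← Unitization.inr_mul]
  congr 2
  simp [DendExt.R, Dend.mul_def, Dend.smul_def, Dend.op_smul_def, add_comm]

end Bimodule

/-! ### From rooted trees and noncommutative symmetric functions to planar binary trees -/

section Comparison

variable {K : Type} [Field K]

theorem phi_vertex : phi K PL.vertex = Dend.Y :=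
  (PL.existsUnique_hom (K := K) Dend.preLie Dend.preLie_axiom Dend.Y).choose_spec.1.1

theorem phi_graft (x y : PL K) : phi K (PL.graft x y) = Dend.preLie (phi K x) (phi K y) :=
  (PL.existsUnique_hom (K := K) Dend.preLie Dend.preLie_axiom Dend.Y).choose_spec.1.2 x y

/-- The series `∑ φ(Aₙ) tⁿ`, whose coefficients lie in the bimodule `Dend`. -/
noncomputable def phiSeries : PLhat K →ₗ[K] (DendExt K)⟦X⟧ where
  toFun A := PowerSeries.mk fun n => TrivSqZeroExt.inr (phi K (A n))
  map_add' A C := by ext n : 1; simp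
  map_smul' c A := by ext n : 1; simp

theorem coeff_phiSeries (A : PLhat K) (n : ℕ) :
    coeff n (phiSeries A) = TrivSqZeroExt.inr (phi K (A n)) :=
  coeff_mk n fun n => TrivSqZeroExt.inr (phi K (A n))

theorem constantCoeff_phiSeries (A : PLhat K) : constantCoeff (phiSeries A) = 0 := by
  rw [← coeff_zero_eq_constantCoeff_apply, coeff_phiSeries, PLhat.zero_eq (A 0),
    ZeroMemClass.coe_zero, map_zero, TrivSqZeroExt.inr_zero]

theorem phiSeries_vertex : phiSeries (PLhat.vertex : PLhat K) =
    monomial 1 (TrivSqZeroExt.inr Dend.Y) := by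
  ext n : 1
  rw [coeff_phiSeries, coeff_monomial, PLhat.vertex]
  split_ifs with hn
  · rw [hn, Pi.single_eq_same, phi_vertex]
  · rw [Pi.single_eq_of_ne hn, ZeroMemClass.coe_zero, map_zero, TrivSqZeroExt.inr_zero]

theorem phiSeries_shift (c : K) (A : PLhat K) :
    phiSeries (PLhat.shift c A) = dilate c (phiSeries A) := by
  ext n : 1
  simp [coeff_phiSeries, coeff_dilate, PLhat.shift]

theorem phiSeries_graft (A C : PLhat K) :
    phiSeries (PLhat.graft A C) = ad K (mapCoeff (DendExt.R K) (phiSeries C)) (phiSeries A) := by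
  have hpreLie (x y : Dend K) : (TrivSqZeroExt.inr (Dend.preLie x y) : DendExt K) =
      DendExt.R K (TrivSqZeroExt.inr y) * TrivSqZeroExt.inr x -
        TrivSqZeroExt.inr x * DendExt.R K (TrivSqZeroExt.inr y) := by
    simp [DendExt.R_inr, Dend.smul_def, Dend.op_smul_def, Dend.preLie_apply,
      TrivSqZeroExt.inl_mul_inr, TrivSqZeroExt.inr_mul_inl, TrivSqZeroExt.inr_sub]
  ext n : 1
  rw [ad_apply, map_sub, coeff_mul, coeff_mul, ← Finset.Nat.sum_antidiagonal_swap,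
    ← Finset.sum_sub_distrib, coeff_phiSeries, PLhat.graft]
  simp only [coeff_mapCoeff, coeff_phiSeries, map_sum, phi_graft, Prod.fst_swap, Prod.snd_swap,
    ← hpreLie]
  exact map_sum (TrivSqZeroExt.inrHom (Unitization K (Dend K)) (Dend K)) _ _

theorem phiSeries_iterate_graft (A x : PLhat K) (k : ℕ) :
    phiSeries ((fun z => PLhat.graft z A)^[k] x) =
      (ad K (mapCoeff (DendExt.R K) (phiSeries A)) ^ k) (phiSeries x) := by
  induction k with
  | zero => simp
  | succ k ih =>
    rw [Function.iterate_succ_apply', phiSeries_graft, ih, pow_succ', Module.End.mul_apply]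

theorem phiSeries_act (f : K⟦X⟧) (A x : PLhat K) :
    phiSeries (PLhat.act f A x) =
      opEval f (ad K (mapCoeff (DendExt.R K) (phiSeries A))) (phiSeries x) := by
  ext n : 1
  rw [opEval, seriesSum, coeff_mk, coeff_phiSeries, PLhat.act, AddSubmonoidClass.coe_finsetSum,
    map_sum, ← TrivSqZeroExt.inrHom_apply (R := Unitization K (Dend K)), map_sum]
  refine Finset.sum_congr rfl fun k _ => ?_
  rw [← phiSeries_iterate_graft, coeff_smul, coeff_phiSeries]
  simp

theorem Sym.sum_S_mul_Psi (n : ℕ) :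
    ∑ p ∈ antidiagonal n, Sym.S K p.1 * Sym.Psi K p.2 = (n : K) • Sym.S K n := by
  rw [Sym.smul_S, Finset.Nat.sum_antidiagonal_eq_sum_range_succ
    (fun i j => Sym.S K i * Sym.Psi K j), Finset.sum_range_succ, Nat.sub_self, Sym.Psi_zero,
    mul_zero, add_zero]

theorem Sym.isQLogDeriv_PsiQ {q : K} (hq : ∀ n : ℕ, 0 < n → q ^ n ≠ 1) :
    IsQLogDeriv q (PowerSeries.mk (Sym.S K)) (PowerSeries.mk fun n => (1 - q) • Sym.PsiQ q n) := by
  ext n : 1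
  have h := congrArg ((1 - q) • ·) (Sym.PsiQ_eq hq n)
  rw [Sym.sum_S_mul_Psi, Nat.cast_smul_eq_nsmul] at h
  simp only [smul_add, Finset.smul_sum] at h
  simp only [map_add, coeff_mul, coeff_smul, coeff_dilate, coeff_euler, coeff_mk, mul_smul_comm,
    smul_mul_assoc, smul_comm (q ^ _) (1 - q)]
  exact h

theorem theta_S_succ (n : ℕ) :
    theta K (Sym.S K (n + 1)) = (leftComb K n : Unitization K (Dend K)) := by
  simp [theta, Sym.S]

variable (K) in
/-- The map `θ` with values in the subalgebra of `DendExt` complementary to the bimodule. -/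
noncomputable def thetaExt : Sym K →ₐ[K] DendExt K :=
  (TrivSqZeroExt.inlAlgHom K (Unitization K (Dend K)) (Dend K)).comp (theta K)

theorem thetaExt_S_succ (n : ℕ) : thetaExt K (Sym.S K (n + 1)) =
    DendExt.R K (thetaExt K (Sym.S K n) * TrivSqZeroExt.inr Dend.Y) := by
  simp only [thetaExt, AlgHom.comp_apply, TrivSqZeroExt.inlAlgHom_apply,
    TrivSqZeroExt.inl_mul_inr, DendExt.R_inr, theta_S_succ]
  congr 2
  rcases n with _ | n
  · simp [Sym.S, leftComb]
  · simp [theta_S_succ, Dend.smul_def, leftComb]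

theorem mapAlgHom_thetaExt_S : mapAlgHom (thetaExt K) (PowerSeries.mk (Sym.S K)) =
    1 + mapCoeff (DendExt.R K) (mapAlgHom (thetaExt K) (PowerSeries.mk (Sym.S K)) *
      monomial 1 (TrivSqZeroExt.inr Dend.Y)) := by
  ext (_ | n) : 1
  · simp [mapAlgHom_apply, constantCoeff_mapCoeff, constantCoeff_monomial_one, Sym.S]
  · simp [mapAlgHom_apply, coeff_mapCoeff, coeff_succ_mul_monomial_one, thetaExt_S_succ, coeff_one]

theorem dilate_neg_one_mapAlgHom_thetaExt_PsiQ [Algebra ℚ K] {q : K}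
    (hq : ∀ n : ℕ, 0 < n → q ^ n ≠ 1) {A : PLhat K}
    (hA : PLhat.act (PowerSeries.exp K - 1) (Omega K) (PLhat.shift q A) + PLhat.shift q A - A =
      PLhat.graft PLhat.vertex A + (q - 1) • PLhat.vertex) :
    dilate (-1 : K) (mapAlgHom (thetaExt K) (PowerSeries.mk fun n => (1 - q) • Sym.PsiQ q n)) =
      -mapCoeff (DendExt.R K) (phiSeries A) := by
  have hOmega : PLhat.act (bernoulliPowerSeries K) (Omega K) PLhat.vertex = Omega K :=
    (existsUnique_Omega K).choose_spec.1
  replace hOmega := congrArg phiSeries hOmega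
  replace hA := congrArg phiSeries hA
  simp only [phiSeries_act, map_add, map_sub, map_smul, phiSeries_shift, phiSeries_graft,
    phiSeries_vertex] at hOmega hA
  have hz0 : constantCoeff (mapAlgHom (thetaExt K)
      (PowerSeries.mk fun n => (1 - q) • Sym.PsiQ q n)) = 0 := by
    rw [← coeff_zero_eq_constantCoeff_apply, mapAlgHom_apply, coeff_map, coeff_mk, Sym.PsiQ,
      Sym.Psi_zero, map_zero, smul_zero, map_zero]
  exact DendExt.isRotaBaxter_R.dilate_neg_one_eq_neg_mapCoeff hq (constantCoeff_phiSeries _)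
    (constantCoeff_phiSeries _) hz0 hOmega hA mapAlgHom_thetaExt_S
    ((Sym.isQLogDeriv_PsiQ hq).map (thetaExt K))

end Comparison

end QOmega

open QOmega in
theorem mainTheorem1_general {K : Type} [Field K] [Algebra ℚ K] {q : K}
    (hq : ∀ n : ℕ, 0 < n → q ^ n ≠ 1) {A : PLhat K}
    (hA : PLhat.act (PowerSeries.exp K - 1) (Omega K) (PLhat.shift q A) + PLhat.shift q A - A =
      PLhat.graft PLhat.vertex A + (q - 1) • PLhat.vertex) (n : ℕ) :
    theta K ((1 - q) • Sym.PsiQ q n) =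
      ((phi K (PLhat.suspension A n) : Dend K) : Unitization K (Dend K)) := by
  have hn : (-1 : K) ^ n • theta K ((1 - q) • Sym.PsiQ q n) =
      -(phi K (A n) : Unitization K (Dend K)) := by
    have h := congrArg (PowerSeries.coeff n) (dilate_neg_one_mapAlgHom_thetaExt_PsiQ hq hA)
    rw [coeff_dilate, PowerSeries.mapAlgHom_apply, PowerSeries.coeff_map, PowerSeries.coeff_mk,
      map_neg, coeff_mapCoeff, coeff_phiSeries, DendExt.R_inr] at h
    exact congrArg TrivSqZeroExt.fst h
  calc theta K ((1 - q) • Sym.PsiQ q n)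
      = (-1 : K) ^ n • (-1 : K) ^ n • theta K ((1 - q) • Sym.PsiQ q n) := by
        rw [smul_smul, ← mul_pow, neg_one_mul, neg_neg, one_pow, one_smul]
    _ = ((phi K (PLhat.suspension A n) : Dend K) : Unitization K (Dend K)) := by
        rw [hn, PLhat.suspension, Submodule.coe_smul, map_smul, Unitization.inr_smul, pow_succ,
          mul_neg_one, neg_smul, smul_neg]

theorem mainTheorem1 (n : ℕ) (hn : 1 ≤ n) :
    QOmega.theta QOmega.Qq ((1 - QOmega.q) • QOmega.Sym.PsiQ QOmega.q n) =
      ((QOmega.phi QOmega.Qq (QOmega.PLhat.suspension QOmega.OmegaQ n) :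
        QOmega.Dend QOmega.Qq) : Unitization QOmega.Qq (QOmega.Dend QOmega.Qq)) :=
  mainTheorem1_general QOmega.q_pow_ne_one
    (QOmega.existsUnique_OmegaQ QOmega.q_pow_ne_one).choose_spec.1 n
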